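/- Let $(X,\omega)$ be a symplectic manifold of dimension $2n$ and let $B$ be a smooth manifold of dimension $n$. Let $f:X\to B$ be a Lagrangian fibration, that is, a continuous map such that every fiber $L_b=f^{-1}(b)$ contains a relatively open dense subset which is a smooth (embedded) Lagrangian submanifold of $X$. Let $U_b\subset L_b$ be the maximal relatively open subset of $L_b$ which is a smooth Lagrangian submanifold of $X$; call $L_b$ smooth if $U_b=L_b$. Let $X^{sm}=\bigcup_{b\in B}U_b$ be the smooth locus and $X^{sing}=X\setminus X^{sm}$ the singular locus. Suppose that (i) $f$ is tame: the section $s_f:X^{sm}\to LG(X)$ of the Lagrangian Grassmannian bundle of $X$ given by $s_f(p)=T_pL_{f(p)}$ is continuous; (ii) the singular locus has codimension at least $3$: there are countably many smooth manifolds $M_i$ with $\dim M_i\le 2n-3$ and smooth maps $g_i:M_i\to X$ such that $X^{sing}\subset\bigcup_i g_i(M_i)$. Then the first Chern class $c_1(X)=c_1(TX,J)\in H^2(X;\mathbb Z)$, where $J$ is any $\omega$-compatible almost complex structure, is torsion. Moreover, for every $b\in B$ such that the fiber $L_b$ is smooth, the Maslov class $\mu:H_2(X,L_b;\mathbb Z)\to\mathbb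 Z$ of $L_b$ vanishes. -/

import Mathlib

open scoped Manifold ContDiff Topology

noncomputable section

namespace LagFib

universe u v

/-! ### Integral singular homology of a pair and integral singular cohomology -/

section Singular

variable (X : Type u) [TopologicalSpace X]

/-- Singular `k`-simplices of `X`. -/
abbrev Simplex (k : ℕ) : Type u := C(stdSimplex ℝ (Fin (k + 1)), X)

/-- Singular `k`-chains of `X` with integer coefficients. -/
abbrev Chain (k : ℕ) : Type u := Simplex X k →₀ ℤ

/-- Singular `k`-cochains of `X` with integer coefficients. -/
abbrev Cochain (k : ℕ) : Type u := Simplex X k → ℤ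

variable {X}

/-- The inclusion of the `i`-th face (opposite to the `i`-th vertex) of the standard simplex. -/
def faceMap {k : ℕ} (i : Fin (k + 2)) :
    C(stdSimplex ℝ (Fin (k + 1)), stdSimplex ℝ (Fin (k + 2))) :=
  ⟨stdSimplex.map i.succAbove, stdSimplex.continuous_map _⟩

/-- The `i`-th face of a singular simplex. -/
def face {k : ℕ} (σ : Simplex X (k + 1)) (i : Fin (k + 2)) : Simplex X k :=
  σ.comp (faceMap i)

variable (X)

/-- The singular boundary operator. -/
def boundary (k : ℕ) : Chain X (k + 1) →ₗ[ℤ] Chain X k :=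
  Finsupp.linearCombination ℤ fun σ : Simplex X (k + 1) =>
    ∑ i : Fin (k + 2), ((-1 : ℤ) ^ (i : ℕ)) • Finsupp.single (face σ i) (1 : ℤ)

/-- The singular coboundary operator. -/
def coboundary (k : ℕ) : Cochain X k →+ Cochain X (k + 1) where
  toFun c := fun σ => ∑ i : Fin (k + 2), (-1 : ℤ) ^ (i : ℕ) * c (face σ i)
  map_zero' := by
    funext σ
    simp
  map_add' a b := by
    funext σ
    simp [mul_add, Finset.sum_add_distrib]

/-- Integral singular cocycles of degree `k`. -/
abbrev Cocycle (k : ℕ) : AddSubgroup (Cochain X k) := (coboundary X k).ker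

/-- The integral singular cohomology group `H²(X; ℤ)`. -/
abbrev H2 : Type u := Cocycle X 2 ⧸ (coboundary X 1).range.addSubgroupOf (Cocycle X 2)

variable {X}

/-- Singular chains of `X` supported in the subset `L`. -/
def chainsIn (L : Set X) (k : ℕ) : Submodule ℤ (Chain X k) :=
  Finsupp.supported ℤ ℤ {σ : Simplex X k | Set.range σ ⊆ L}

/-- Relative singular 2-cycles of the pair `(X, L)`. -/
def relCycles2 (L : Set X) : Submodule ℤ (Chain X 2) :=
  (chainsIn L 1).comap (boundary X 1)

/-- Relative singular 2-boundaries of the pair `(X, L)`. -/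
def relBoundaries2 (L : Set X) : Submodule ℤ (Chain X 2) :=
  LinearMap.range (boundary X 2) ⊔ chainsIn L 2

/-- The integral relative singular homology group `H₂(X, L; ℤ)`. -/
abbrev RelH2 (L : Set X) : Type u :=
  relCycles2 L ⧸ (relBoundaries2 L).submoduleOf (relCycles2 L)

end Singular

/-! ### Symplectic manifolds and compatible almost complex structures -/

section Symplectic

variable (n : ℕ) (X : Type u) [TopologicalSpace X]
  [ChartedSpace (EuclideanSpace ℝ (Fin (2 * n))) X]

variable {X} in
/-- The tangent space of the `2n`-dimensional manifold `X` at `x`. -/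
abbrev Tan (x : X) : Type := TangentSpace (𝓡 (2 * n)) x

/-- The total space of the tangent bundle of `X`. -/
abbrev TanBundle : Type u := TangentBundle (𝓡 (2 * n)) X

variable {n X} in
/-- The coordinate expression, in the preferred chart around `x₀`, of a field of bilinear forms,
evaluated on the constant vector fields `a`, `b`. -/
def coordForm (Ω : ∀ x : X, Tan n x →L[ℝ] Tan n x →L[ℝ] ℝ) (x₀ : X)
    (a b : EuclideanSpace ℝ (Fin (2 * n))) (y : EuclideanSpace ℝ (Fin (2 * n))) : ℝ :=
  Ω ((extChartAt (𝓡 (2 * n)) x₀).symm y)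
    (mfderiv (𝓡 (2 * n)) (𝓡 (2 * n)) (extChartAt (𝓡 (2 * n)) x₀).symm y a)
    (mfderiv (𝓡 (2 * n)) (𝓡 (2 * n)) (extChartAt (𝓡 (2 * n)) x₀).symm y b)

variable [IsManifold (𝓡 (2 * n)) ∞ X]

/-- A symplectic form: a smooth, closed, nondegenerate 2-form. -/
structure SymplecticForm where
  form : ∀ x : X, Tan n x →L[ℝ] Tan n x →L[ℝ] ℝ
  smooth : ContMDiff (𝓡 (2 * n))
    ((𝓡 (2 * n)).prod 𝓘(ℝ, EuclideanSpace ℝ (Fin (2 * n)) →L[ℝ]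
      EuclideanSpace ℝ (Fin (2 * n)) →L[ℝ] ℝ)) ∞
    (fun x => Bundle.TotalSpace.mk' (EuclideanSpace ℝ (Fin (2 * n)) →L[ℝ]
      EuclideanSpace ℝ (Fin (2 * n)) →L[ℝ] ℝ) x (form x))
  alternating : ∀ (x : X) (a : Tan n x), form x a a = 0
  nondegenerate : ∀ (x : X) (a : Tan n x), (∀ b, form x a b = 0) → a = 0
  /-- `dΩ = 0` in coordinates: `∂_a Ω(b, c) + ∂_b Ω(c, a) + ∂_c Ω(a, b) = 0`. -/
  closed : ∀ x₀ : X, ∀ y ∈ (extChartAt (𝓡 (2 * n)) x₀).target,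
    ∀ a b c : EuclideanSpace ℝ (Fin (2 * n)),
      fderiv ℝ (coordForm form x₀ b c) y a + fderiv ℝ (coordForm form x₀ c a) y b
        + fderiv ℝ (coordForm form x₀ a b) y c = 0

variable {n X}

/-- A smooth almost complex structure `J` compatible with `Ω`: `Ω(·, J ·)` is a Riemannian
metric, and `J` preserves `Ω`. -/
structure CompatibleACS (Ω : SymplecticForm n X) where
  J : ∀ x : X, Tan n x →L[ℝ] Tan n x
  smooth : ContMDiff (𝓡 (2 * n))
    ((𝓡 (2 * n)).prod 𝓘(ℝ, EuclideanSpace ℝ (Fin (2 * n)) →L[ℝ]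
      EuclideanSpace ℝ (Fin (2 * n)))) ∞
    (fun x => Bundle.TotalSpace.mk' (EuclideanSpace ℝ (Fin (2 * n)) →L[ℝ]
      EuclideanSpace ℝ (Fin (2 * n))) x (J x))
  sq : ∀ (x : X) (a : Tan n x), J x (J x a) = -a
  invariant : ∀ (x : X) (a b : Tan n x), Ω.form x (J x a) (J x b) = Ω.form x a b
  positive : ∀ (x : X) (a : Tan n x), a ≠ 0 → 0 < Ω.form x a (J x a)

/-- A linear subspace of `T_x X` is Lagrangian if it equals its own `Ω`-orthogonal complement. -/
def IsLagrangian (Ω : SymplecticForm n X) {x : X} (P : Submodule ℝ (Tan n x)) : Prop :=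
  ∀ a : Tan n x, a ∈ P ↔ ∀ b ∈ P, Ω.form x a b = 0

end Symplectic

/-! ### The Lagrangian Grassmannian bundle -/

section Grassmannian

variable {n : ℕ} {X : Type u} [TopologicalSpace X]
  [ChartedSpace (EuclideanSpace ℝ (Fin (2 * n))) X] [IsManifold (𝓡 (2 * n)) ∞ X]

/-- The Lagrangian Grassmannian bundle `LG(X)`: pairs of a point of `X` and a Lagrangian subspace
of the tangent space at that point. -/
structure LagGrass (Ω : SymplecticForm n X) where
  base : X
  plane : Submodule ℝ (Tan n base)
  isLagrangian : IsLagrangian Ω plane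

/-- The bundle of Lagrangian frames: ordered bases of Lagrangian subspaces of tangent spaces. -/
structure LagFrame (Ω : SymplecticForm n X) where
  base : X
  vec : Fin n → Tan n base
  linearIndependent : LinearIndependent ℝ vec
  isLagrangian : IsLagrangian Ω (Submodule.span ℝ (Set.range vec))

/-- The topology of a subspace of the `n`-fold fibre product of the tangent bundle. -/
instance (Ω : SymplecticForm n X) : TopologicalSpace (LagFrame Ω) :=
  TopologicalSpace.induced
    (fun F => ((F.base, fun i => ⟨F.base, F.vec i⟩) : X × (Fin n → TanBundle n X)))
    inferInstance

/-- The Lagrangian subspace spanned by a Lagrangian frame. -/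
def LagFrame.span {Ω : SymplecticForm n X} (F : LagFrame Ω) : LagGrass Ω :=
  ⟨F.base, Submodule.span ℝ (Set.range F.vec), F.isLagrangian⟩

/-- `LG(X)` is topologized as the quotient of the bundle of Lagrangian frames. -/
instance (Ω : SymplecticForm n X) : TopologicalSpace (LagGrass Ω) :=
  TopologicalSpace.coinduced LagFrame.span inferInstance

end Grassmannian

/-! ### Lagrangian submanifolds and Lagrangian fibrations -/

section Fibration

variable {n : ℕ} {X : Type u} [TopologicalSpace X]
  [ChartedSpace (EuclideanSpace ℝ (Fin (2 * n))) X]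

variable (n) in
/-- The tangent space at `x` of a subset `S` of `X`: the span of the velocities at `x` of smooth
curve germs in `S`. For an embedded submanifold this is its usual tangent space. -/
def tangentTo (S : Set X) (x : X) : Submodule ℝ (Tan n x) :=
  Submodule.span ℝ {a | ∃ γ : ℝ → X, ContMDiffAt 𝓘(ℝ, ℝ) (𝓡 (2 * n)) ∞ γ 0 ∧
    (∀ᶠ t in 𝓝 (0 : ℝ), γ t ∈ S) ∧
    (⟨γ 0, mfderiv 𝓘(ℝ, ℝ) (𝓡 (2 * n)) γ 0 (1 : ℝ)⟩ : TanBundle n X) = ⟨x, a⟩}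

/-- The tangent space of a set at a point only depends on the set near the point. -/
theorem tangentTo_inter_open {S V : Set X} (hV : IsOpen V) {x : X} (hx : x ∈ V) :
    tangentTo n (V ∩ S) x = tangentTo n S x := by
  unfold tangentTo
  congr 1
  ext a
  constructor
  · rintro ⟨γ, h1, h2, h3⟩
    exact ⟨γ, h1, h2.mono fun t ht => ht.2, h3⟩
  · rintro ⟨γ, h1, h2, h3⟩
    have h0 : γ 0 = x := congrArg Bundle.TotalSpace.proj h3
    have hV' : ∀ᶠ t in 𝓝 (0 : ℝ), γ t ∈ V :=
      h1.continuousAt.eventually (hV.mem_nhds (by rw [h0]; exact hx))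
    exact ⟨γ, h1, hV'.and h2, h3⟩

/-- `U` is an embedded smooth submanifold of `X`: near each of its points it is cut out by a
linear subspace in some smooth chart of `X`. -/
def IsSubmanifold (n : ℕ) {X : Type u} [TopologicalSpace X]
    [ChartedSpace (EuclideanSpace ℝ (Fin (2 * n))) X] (U : Set X) : Prop :=
  ∀ x ∈ U, ∃ φ ∈ IsManifold.maximalAtlas (𝓡 (2 * n)) ∞ X, x ∈ φ.source ∧
    ∃ W : Submodule ℝ (EuclideanSpace ℝ (Fin (2 * n))), ∀ q ∈ φ.source, q ∈ U ↔ φ q ∈ W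

variable [IsManifold (𝓡 (2 * n)) ∞ X]

/-- `U` is a smooth (embedded) Lagrangian submanifold of `(X, Ω)`. -/
def IsLagrangianSubmanifold (Ω : SymplecticForm n X) (U : Set X) : Prop :=
  IsSubmanifold n U ∧ ∀ x ∈ U, IsLagrangian Ω (tangentTo n U x)

variable {B : Type v}

/-- `U` is a relatively open subset of the fiber of `f` over `b` which is a smooth Lagrangian
submanifold of `X`. -/
def IsOpenLagrangianPart (Ω : SymplecticForm n X) (f : X → B) (b : B) (U : Set X) : Prop :=
  (∃ V : Set X, IsOpen V ∧ U = V ∩ f ⁻¹' {b}) ∧ IsLagrangianSubmanifold Ω U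

/-- `f : X → B` is a Lagrangian fibration: a continuous map each of whose fibers contains a
relatively open dense subset that is a smooth Lagrangian submanifold of `X`. -/
structure IsLagrangianFibration [TopologicalSpace B] (Ω : SymplecticForm n X) (f : X → B) :
    Prop where
  continuous : Continuous f
  exists_dense_part : ∀ b : B, ∃ U : Set X,
    IsOpenLagrangianPart Ω f b U ∧ f ⁻¹' {b} ⊆ closure U

/-- `U_b`, the largest relatively open subset of the fiber over `b` which is a smooth Lagrangian
submanifold. -/
def smoothPart (Ω : SymplecticForm n X) (f : X → B) (b : B) : Set X :=
  ⋃₀ {U | IsOpenLagrangianPart Ω f b U}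

/-- The fiber over `b` is smooth if it coincides with `U_b`. -/
def IsSmoothFiber (Ω : SymplecticForm n X) (f : X → B) (b : B) : Prop :=
  smoothPart Ω f b = f ⁻¹' {b}

/-- The smooth locus of `X`: the union of the sets `U_b`. -/
def smoothLocus (Ω : SymplecticForm n X) (f : X → B) : Set X :=
  ⋃ b : B, smoothPart Ω f b

/-- The tangent space of the fiber at a point of the smooth locus is Lagrangian. -/
theorem isLagrangian_tangentTo_fiber (Ω : SymplecticForm n X) (f : X → B) {x : X}
    (hx : x ∈ smoothLocus Ω f) : IsLagrangian Ω (tangentTo n (f ⁻¹' {f x}) x) := by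
  obtain ⟨b, hb⟩ := Set.mem_iUnion.1 hx
  obtain ⟨U, ⟨⟨V, hV, rfl⟩, hU⟩, hxU⟩ := hb
  have hfx : f x = b := hxU.2
  subst hfx
  have h := hU.2 x hxU
  rwa [tangentTo_inter_open hV hxU.1] at h

/-- The section `s_f` of `LG(X)` over the smooth locus, `s_f(p) = T_p L_{f(p)}`. -/
def tangentSection (Ω : SymplecticForm n X) (f : X → B) (p : smoothLocus Ω f) : LagGrass Ω :=
  ⟨p.1, tangentTo n (f ⁻¹' {f p.1}) p.1, isLagrangian_tangentTo_fiber Ω f p.2⟩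

/-- A Lagrangian fibration is tame if `s_f` is continuous. -/
def IsTame (Ω : SymplecticForm n X) (f : X → B) : Prop :=
  Continuous (tangentSection Ω f)

/-- A subset `S` of the `2n`-dimensional manifold `X` has codimension at least `k`: it is covered
by the images of countably many smooth maps from (second countable, Hausdorff) manifolds of
dimension at most `2n - k`. -/
def HasCodimAtLeast (n : ℕ) {X : Type u} [TopologicalSpace X]
    [ChartedSpace (EuclideanSpace ℝ (Fin (2 * n))) X] (S : Set X) (k : ℕ) : Prop :=
  ∃ (ι : Type) (_ : Countable ι) (m : ι → ℕ) (M : ι → Type) (_ : ∀ i, TopologicalSpace (M i))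
    (_ : ∀ i, ChartedSpace (EuclideanSpace ℝ (Fin (m i))) (M i)) (g : ∀ i, M i → X),
    (∀ i, T2Space (M i) ∧ SecondCountableTopology (M i) ∧ IsManifold (𝓡 (m i)) ∞ (M i) ∧
      m i + k ≤ 2 * n ∧ ContMDiff (𝓡 (m i)) (𝓡 (2 * n)) ∞ (g i)) ∧
    S ⊆ ⋃ i, Set.range (g i)

end Fibration

/-! ### The first Chern class and the Maslov class as primary obstructions -/

section Classes

variable {n : ℕ} {X : Type u} [TopologicalSpace X]
  [ChartedSpace (EuclideanSpace ℝ (Fin (2 * n))) X] [IsManifold (𝓡 (2 * n)) ∞ X]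
  {Ω : SymplecticForm n X}

/-- `v` is a basis of the complex vector space `(T_x X, J)`. -/
def IsComplexFrame (J : CompatibleACS Ω) (x : X) (v : Fin n → Tan n x) : Prop :=
  LinearIndependent ℝ (Sum.elim v fun i => J.J x (v i))

/-- `A` is the complex matrix expressing the vectors `w` through the vectors `v`:
`w_j = ∑ i, A_ij v_i` in the complex vector space `(T_x X, J)`. -/
def IsTransition (J : CompatibleACS Ω) (x : X) (v w : Fin n → Tan n x)
    (A : Matrix (Fin n) (Fin n) ℂ) : Prop :=
  ∀ j, w j = ∑ i, ((A i j).re • v i + (A i j).im • J.J x (v i))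

/-- A continuous complex frame of the pullback of `(TX, J)` by a singular simplex. -/
structure FrameAlong (J : CompatibleACS Ω) {k : ℕ} (σ : Simplex X k) where
  vec : ∀ t, Fin n → Tan n (σ t)
  continuous : ∀ i, Continuous fun t => (⟨σ t, vec t i⟩ : TanBundle n X)
  isFrame : ∀ t, IsComplexFrame J (σ t) (vec t)

/-- The restriction of a frame to a face. -/
def FrameAlong.face {J : CompatibleACS Ω} {k : ℕ} {σ : Simplex X (k + 1)} (F : FrameAlong J σ)
    (i : Fin (k + 2)) : FrameAlong J (face σ i) where
  vec t := F.vec (faceMap i t)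
  continuous j := (F.continuous j).comp (faceMap i).continuous
  isFrame t := F.isFrame (faceMap i t)

/-- `r` is the rotation (in full turns), along the path `e`, of the `m`-th power of the
determinant of the frame `G` relative to the frame `F`. -/
def IsRotation {J : CompatibleACS Ω} (m : ℕ) {e : Simplex X 1} (F G : FrameAlong J e) (r : ℝ) :
    Prop :=
  ∃ (A : stdSimplex ℝ (Fin 2) → Matrix (Fin n) (Fin n) ℂ) (θ : stdSimplex ℝ (Fin 2) → ℝ),
    (∀ t, IsTransition J (e t) (F.vec t) (G.vec t) (A t)) ∧ Continuous θ ∧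
    (∀ t, (A t).det ^ m = ‖(A t).det ^ m‖ * Complex.exp (θ t * Complex.I)) ∧
    2 * Real.pi * r = θ (stdSimplex.vertex 1) - θ (stdSimplex.vertex 0)

/-- Through the frames `v_1, …, v_n`, this represents a choice of nowhere vanishing sections
`(v_1 ∧ … ∧ v_n)^{⊗ m}` of the `m`-th tensor power of the determinant line bundle of `(TX, J)`
along all vertices and all singular edges of `X`, such that the sections along an edge restrict,
up to positive factors, to the ones chosen at its two end points. -/
structure Framing (J : CompatibleACS Ω) (m : ℕ) where
  vertexFrame : ∀ x : X, Fin n → Tan n x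
  vertexFrame_isFrame : ∀ x, IsComplexFrame J x (vertexFrame x)
  edgeFrame : ∀ e : Simplex X 1, FrameAlong J e
  matching : ∀ (e : Simplex X 1) (j : Fin 2), ∃ A : Matrix (Fin n) (Fin n) ℂ,
    IsTransition J (e (stdSimplex.vertex j)) (vertexFrame (e (stdSimplex.vertex j)))
      ((edgeFrame e).vec (stdSimplex.vertex j)) A ∧ ∃ r : ℝ, 0 < r ∧ A.det ^ m = r

/-- `k` is the winding number around the boundary of the singular triangle `σ`, with respect to a
trivialization over `σ`, of the nowhere vanishing section given by the framing. -/
def Framing.IsWinding {J : CompatibleACS Ω} {m : ℕ} (Φ : Framing J m) (σ : Simplex X 2) (k : ℤ) :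
    Prop :=
  ∃ (F : FrameAlong J σ) (r : Fin 3 → ℝ),
    (∀ i, IsRotation m (F.face i) (Φ.edgeFrame (LagFib.face σ i)) (r i)) ∧
      (k : ℝ) = r 0 - r 1 + r 2

/-- `c` is the first Chern class of `(TX, J)`: the primary obstruction to the existence of a
nowhere vanishing section of the determinant line bundle (equivalently, of a complex frame of
`TX`), that is, the class of the cocycle of winding numbers of any framing over the singular
1-skeleton. -/
def IsFirstChernClass (J : CompatibleACS Ω) (c : H2 X) : Prop :=
  ∃ (Φ : Framing J 1) (z : Cocycle X 2),
    (∀ σ, Φ.IsWinding σ (z.1 σ)) ∧ c = QuotientAddGroup.mk z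

/-- A framing for the square of the determinant line bundle is adapted to the Lagrangian
submanifold `L` if along edges in `L` it is given by real frames of `TL`. -/
def Framing.IsAdapted {J : CompatibleACS Ω} (Φ : Framing J 2) (L : Set X) : Prop :=
  ∀ e : Simplex X 1, Set.range e ⊆ L → ∀ t i, (Φ.edgeFrame e).vec t i ∈ tangentTo n L (e t)

/-- `μ` is the Maslov class `H₂(X, L; ℤ) → ℤ` of the Lagrangian submanifold `L`: the total
winding number, relative to trivializations of `TX` over the triangles of a relative cycle, of the
section of the square of the determinant line bundle given on `L` by the squares of the
determinants of real frames of `TL`. -/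
def IsMaslovClass (J : CompatibleACS Ω) (L : Set X) (μ : RelH2 L →+ ℤ) : Prop :=
  ∃ (Φ : Framing J 2) (k : Simplex X 2 → ℤ), Φ.IsAdapted L ∧ (∀ σ, Φ.IsWinding σ (k σ)) ∧
    ∀ z : relCycles2 L, μ (Submodule.Quotient.mk z) = z.1.sum fun σ a => a * k σ

end Classes

end LagFib

end

/-! A compatible `J` makes every Lagrangian plane totally real: a real basis of the plane is a
complex frame of the tangent space, and the square of its determinant is well defined up to a
positive factor. The tangent planes of the fibers therefore give, over the smooth locus, a nowhere
vanishing section of the square of the determinant line bundle up to positive scale, continuous by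
tameness. If this section extends over `X` up to homotopy, then `2 c₁ = 0`. Since along a smooth
fiber it is also the reference section that defines the Maslov class, that class vanishes too.

The extension exists because a set of codimension three neither disconnects small balls nor creates
loops in them. In a chart, almost every point can be coned to a given segment without meeting the
singular set, except perhaps on the segment itself (`isThin_image`). Hence circle-valued functions
on a punctured ball have real logarithms (`IsThin.exists_lift`), and in local frames the phase of
the section is `exp θ_i` on the smooth locus. On overlaps `θ_i - θ_j` is a logarithm of the
transition function, which is continuous everywhere, so the difference extends over the singular
points. The resulting real Čech cocycle is split by a partition of unity as `η_i - η_j`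
(`exists_lift_cocycle`). The phases `exp η_i` define the global section, and the differences `θ_i -
η_i` glue to a real function `ζ` on the smooth locus, which is the homotopy (`exists_phaseSection`).

Measuring the arguments of a framing against the global section writes its winding numbers as the
coboundary of an integral cochain `h` (`Framing.exists_eq_coboundary`). For the square of a framing
this shows that twice the Chern cocycle is exact. For a framing adapted to a smooth fiber, `h`
vanishes on the edges in that fiber, so the Maslov sum of a relative cycle `z` is `h (∂z) = 0`. The
existence of both classes is proved by patching local frames over singular triangles and edges. -/

noncomputable section

namespace LagFib

universe u v

/-! ### Phases of complex numbers -/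

section Phase

/-- The phase `z / ‖z‖` of a nonzero complex number. -/
def phase (z : ℂ) : Circle := Circle.exp z.arg

theorem norm_mul_phase (z : ℂ) : (‖z‖ : ℂ) * phase z = z := by
  rw [phase, Circle.coe_exp, Complex.norm_mul_exp_arg_mul_I]

theorem coe_phase {z : ℂ} (hz : z ≠ 0) : (phase z : ℂ) = z / ‖z‖ := by
  have h : (‖z‖ : ℂ) ≠ 0 := by simpa using hz
  rw [eq_div_iff h, mul_comm, norm_mul_phase]

theorem phase_mul {z w : ℂ} (hz : z ≠ 0) (hw : w ≠ 0) : phase (z * w) = phase z * phase w := by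
  apply Subtype.ext
  rw [Circle.coe_mul, coe_phase hz, coe_phase hw, coe_phase (mul_ne_zero hz hw), norm_mul]
  push_cast
  exact (div_mul_div_comm _ _ _ _).symm

theorem phase_pow {z : ℂ} (hz : z ≠ 0) (m : ℕ) : phase (z ^ m) = phase z ^ m := by
  induction m with
  | zero => simp [phase]
  | succ k ih => rw [pow_succ, pow_succ, phase_mul (pow_ne_zero k hz) hz, ih]

theorem phase_ofReal {r : ℝ} (hr : 0 < r) : phase (r : ℂ) = 1 := by
  simp [phase, Complex.arg_ofReal_of_nonneg hr.le]

theorem continuousAt_phase {z : ℂ} (hz : z ≠ 0) : ContinuousAt phase z := by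
  have h1 : ContinuousAt (fun w : ℂ => w / ‖w‖) z := by
    refine continuousAt_id.div ?_ (by simpa using hz)
    exact (Complex.continuous_ofReal.comp continuous_norm).continuousAt
  have h2 : ContinuousAt (fun w : ℂ => (phase w : ℂ)) z := by
    refine h1.congr ?_
    filter_upwards [isOpen_ne.mem_nhds hz] with w hw
    exact (coe_phase hw).symm
  exact (Topology.IsInducing.subtypeVal.continuousAt_iff).2 h2

theorem eq_norm_mul_exp_iff {z : ℂ} (hz : z ≠ 0) (θ : ℝ) :
    z = ‖z‖ * Complex.exp (θ * Complex.I) ↔ Circle.exp θ = phase z := by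
  have h : (‖z‖ : ℂ) ≠ 0 := by simpa using hz
  constructor
  · intro h1
    apply Subtype.ext
    rw [Circle.coe_exp, coe_phase hz, eq_div_iff h, mul_comm]
    exact h1.symm
  · intro h1
    rw [← Circle.coe_exp, h1, norm_mul_phase]

theorem exists_int_of_exp_eq {a b : ℝ} (h : Circle.exp a = Circle.exp b) :
    ∃ k : ℤ, a - b = k * (2 * Real.pi) := by
  obtain ⟨k, hk⟩ := Circle.exp_eq_exp.1 h
  exact ⟨k, by rw [hk]; ring⟩

/-- A continuous circle-valued function on a convex set has a continuous real lift. -/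
theorem exists_lift_of_convex {E : Type*} [NormedAddCommGroup E] [NormedSpace ℝ E] {S : Set E}
    (hS : Convex ℝ S) (τ : S → Circle) (hτ : Continuous τ) :
    ∃ θ : S → ℝ, Continuous θ ∧ ∀ t, Circle.exp (θ t) = τ t := by
  rcases S.eq_empty_or_nonempty with h | ⟨a, ha⟩
  · subst h
    exact ⟨fun _ => 0, continuous_const, fun t => t.2.elim⟩
  have : LocallyPathConnectedSpace S := hS.locallyPathConnectedSpace
  have : ContractibleSpace S := hS.contractibleSpace ⟨a, ha⟩
  obtain ⟨θ0, hθ0⟩ := Circle.exp_surjective (τ ⟨a, ha⟩)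
  obtain ⟨F, ⟨-, hF⟩, -⟩ := Circle.isCoveringMap_exp.existsUnique_continuousMap_lifts
    ⟨τ, hτ⟩ ⟨a, ha⟩ θ0 hθ0
  exact ⟨F, F.continuous, fun t => congrFun hF t⟩

/-- Two continuous lifts of the same function on a preconnected set have the same increments. -/
theorem sub_eq_sub_of_lift {T : Type*} [TopologicalSpace T] {S : Set T} (hS : IsPreconnected S)
    {θ θ' : T → ℝ} (h : ContinuousOn θ S) (h' : ContinuousOn θ' S)
    (he : ∀ t ∈ S, Circle.exp (θ t) = Circle.exp (θ' t)) {s t : T} (hs : s ∈ S) (ht : t ∈ S) :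
    θ t - θ s = θ' t - θ' s := by
  have hpi : (0 : ℝ) < 2 * Real.pi := Real.two_pi_pos
  have hc : ContinuousOn (fun x => (θ x - θ' x) / (2 * Real.pi)) S := (h.sub h').div_const _
  -- The difference of the lifts divided by `2π` is continuous and integer valued, hence constant on
  -- `S`.
  choose k hk using fun x : S => exists_int_of_exp_eq (he x.1 x.2)
  have hk' : ∀ x : S, (θ x - θ' x) / (2 * Real.pi) = k x := fun x => by
    rw [hk x]; field_simp
  have hkc : Continuous k := by
    rw [Int.isClosedEmbedding_coe_real.isInducing.continuous_iff]
    have := continuousOn_iff_continuous_domRestrict.1 hc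
    convert this using 1
    funext x
    exact (hk' x).symm
  have := isPreconnected_iff_preconnectedSpace.1 hS
  have hh := PreconnectedSpace.constant (‹PreconnectedSpace S›) hkc (x := ⟨s, hs⟩) (y := ⟨t, ht⟩)
  have h1 := hk ⟨s, hs⟩
  have h2 := hk ⟨t, ht⟩
  rw [hh] at h1
  simp only at h1 h2
  linarith

end Phase

/-! ### Complements of thin sets in convex open sets -/

section Thin

open MeasureTheory

variable {d : ℕ}

/-- `S` is thin if almost every cone over any given segment avoids `S`, except possibly along the
segment itself. Sets of codimension at least `3` have this property. -/
def IsThin (S : Set (EuclideanSpace ℝ (Fin d))) : Prop :=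
  ∀ q r : EuclideanSpace ℝ (Fin d), ∀ᵐ p, ∀ a b c : ℝ, 0 < a → a + b + c = 1 →
    a • p + b • q + c • r ∉ S

theorem exists_mem_of_ae {U : Set (EuclideanSpace ℝ (Fin d))} (hU : IsOpen U) (hne : U.Nonempty)
    {P : EuclideanSpace ℝ (Fin d) → Prop} (hP : ∀ᵐ p, P p) : ∃ p ∈ U, P p := by
  by_contra h
  push Not at h
  exact (hU.measure_pos volume hne).ne' (measure_mono_null (fun p hp => h p hp) hP)

/-- The degenerate cone `q = r`. Thinness covers every point of the segment except `q`, and `q`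
avoids `S` by assumption. -/
theorem IsThin.ae_segment {S D : Set (EuclideanSpace ℝ (Fin d))} (hS : IsThin S)
    (hD : Convex ℝ D) {q : EuclideanSpace ℝ (Fin d)} (hq : q ∈ D \ S) :
    ∀ᵐ p, p ∈ D → segment ℝ q p ⊆ D \ S := by
  filter_upwards [hS q q] with p hp hpD
  rintro _ ⟨a, b, ha, hb, hab, rfl⟩
  refine ⟨hD hq.1 hpD ha hb hab, ?_⟩
  rcases hb.eq_or_lt with rfl | hb
  · obtain rfl : a = 1 := by linarith
    simpa using hq.2
  · have := hp b a 0 hb (by linarith)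
    simpa [add_comm] using this

/-- Points with a positive coefficient at the apex are handled by thinness. The others lie on the
base, which avoids `S` by hypothesis. -/
theorem IsThin.ae_triangle {S D : Set (EuclideanSpace ℝ (Fin d))} (hS : IsThin S)
    (hD : Convex ℝ D) {q r : EuclideanSpace ℝ (Fin d)} (hqr : segment ℝ q r ⊆ D \ S) :
    ∀ᵐ p, p ∈ D → convexHull ℝ {p, q, r} ⊆ D \ S := by
  filter_upwards [hS q r] with p hp hpD
  have hq := hqr (left_mem_segment ℝ q r)
  have hr := hqr (right_mem_segment ℝ q r)
  intro x hx
  refine ⟨convexHull_min ?_ hD hx, ?_⟩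
  · rintro y (rfl | rfl | rfl)
    exacts [hpD, hq.1, hr.1]
  · rw [convexHull_insert (by simp), convexHull_pair, mem_convexJoin] at hx
    obtain ⟨p', hp', y, ⟨b, c, hb, hc, hbc, rfl⟩, s, t, hs, ht, hst, rfl⟩ := hx
    obtain rfl : p' = p := hp'
    rcases hs.eq_or_lt with rfl | hs
    · obtain rfl : t = 1 := by linarith
      simpa using (hqr ⟨b, c, hb, hc, hbc, rfl⟩).2
    · have := hp s (t * b) (t * c) hs (by rw [add_assoc, ← mul_add, hbc, mul_one, hst])
      simpa [smul_add, smul_smul, add_assoc] using this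

/-- Two points are joined by a broken line through a generic third point, visible from both. -/
theorem IsThin.isPreconnected {S D : Set (EuclideanSpace ℝ (Fin d))} (hS : IsThin S)
    (hD : IsOpen D) (hc : Convex ℝ D) : IsPreconnected (D \ S) := by
  refine isPreconnected_of_forall_pair fun x hx y hy => ?_
  obtain ⟨p, hp, h1, h2⟩ := exists_mem_of_ae hD ⟨x, hx.1⟩
    ((hS.ae_segment hc hx).and (hS.ae_segment hc hy))
  refine ⟨segment ℝ x p ∪ segment ℝ y p, Set.union_subset (h1 hp) (h2 hp),
    Or.inl (left_mem_segment ℝ x p), Or.inr (left_mem_segment ℝ y p), ?_⟩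
  exact IsPreconnected.union p (right_mem_segment ℝ x p) (right_mem_segment ℝ y p)
    (convex_segment x p).isPreconnected (convex_segment y p).isPreconnected

variable {E : Type*} [NormedAddCommGroup E] [NormedSpace ℝ E]

theorem exists_liftOn_of_convex {K : Set E} (hK : Convex ℝ K) {τ : E → Circle}
    (hτ : ContinuousOn τ K) :
    ∃ θ : E → ℝ, ContinuousOn θ K ∧ ∀ t ∈ K, Circle.exp (θ t) = τ t := by
  classical
  obtain ⟨θ, hθ, h⟩ := exists_lift_of_convex hK _ (continuousOn_iff_continuous_domRestrict.1 hτ)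
  refine ⟨fun t => if ht : t ∈ K then θ ⟨t, ht⟩ else 0, ?_, fun t ht => ?_⟩
  · rw [continuousOn_iff_continuous_domRestrict]
    convert hθ using 1
    funext t
    simp [Set.domRestrict]
  · simpa [ht, Set.domRestrict] using h ⟨t, ht⟩

open Classical in
/-- The increment of the argument of `τ` along the segment from `x` to `y`. -/
def argIncrement (τ : E → Circle) (x y : E) : ℝ :=
  -- The value `0` is a convention for segments without a continuous lift; the lemmas below always
  -- supply one.
  if h : ∃ θ : E → ℝ, ContinuousOn θ (segment ℝ x y) ∧
    ∀ t ∈ segment ℝ x y, Circle.exp (θ t) = τ t then h.choose y - h.choose x else 0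

theorem argIncrement_eq {τ : E → Circle} {θ : E → ℝ} {K : Set E} (hθ : ContinuousOn θ K)
    (h : ∀ t ∈ K, Circle.exp (θ t) = τ t) {x y : E} (hxy : segment ℝ x y ⊆ K) :
    argIncrement τ x y = θ y - θ x := by
  have hex : ∃ θ : E → ℝ, ContinuousOn θ (segment ℝ x y) ∧
      ∀ t ∈ segment ℝ x y, Circle.exp (θ t) = τ t :=
    ⟨θ, hθ.mono hxy, fun t ht => h t (hxy ht)⟩
  rw [argIncrement, dif_pos hex]
  exact sub_eq_sub_of_lift (convex_segment x y).isPreconnected hex.choose_spec.1 (hθ.mono hxy)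
    (fun t ht => (hex.choose_spec.2 t ht).trans (h t (hxy ht)).symm)
    (left_mem_segment ℝ x y) (right_mem_segment ℝ x y)

theorem argIncrement_add {τ : E → Circle} {K : Set E} (hK : Convex ℝ K) (hτ : ContinuousOn τ K)
    {x y z : E} (hx : x ∈ K) (hy : y ∈ K) (hz : z ∈ K) :
    argIncrement τ x y + argIncrement τ y z = argIncrement τ x z := by
  obtain ⟨θ, hθ, h⟩ := exists_liftOn_of_convex hK hτ
  rw [argIncrement_eq hθ h (hK.segment_subset hx hy), argIncrement_eq hθ h (hK.segment_subset hy hz),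
    argIncrement_eq hθ h (hK.segment_subset hx hz)]
  ring

/-- A filled triangle inside the domain of continuity carries no monodromy. This replaces simple
connectedness in the construction of the lift. -/
theorem argIncrement_add_of_triangle {τ : E → Circle} {G : Set E} (hτ : ContinuousOn τ G)
    {p q r : E} (h : convexHull ℝ {p, q, r} ⊆ G) :
    argIncrement τ p q + argIncrement τ q r = argIncrement τ p r :=
  argIncrement_add (convex_convexHull ℝ _) (hτ.mono h) (subset_convexHull ℝ _ (by simp))
    (subset_convexHull ℝ _ (by simp)) (subset_convexHull ℝ _ (by simp))

theorem argIncrement_symm {τ : E → Circle} {x y : E} (hτ : ContinuousOn τ (segment ℝ x y)) :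
    argIncrement τ y x = -argIncrement τ x y := by
  obtain ⟨θ, hθ, h⟩ := exists_liftOn_of_convex (convex_segment x y) hτ
  rw [argIncrement_eq hθ h subset_rfl, argIncrement_eq hθ h (segment_symm ℝ y x).subset]
  ring

theorem exp_argIncrement {τ : E → Circle} {x y : E} (hτ : ContinuousOn τ (segment ℝ x y)) :
    τ y = τ x * Circle.exp (argIncrement τ x y) := by
  obtain ⟨θ, hθ, h⟩ := exists_liftOn_of_convex (convex_segment x y) hτ
  rw [argIncrement_eq hθ h subset_rfl, ← h x (left_mem_segment ℝ x y),
    ← h y (right_mem_segment ℝ x y), ← Circle.exp_add]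
  congr 1; ring

/-- A circle-valued function near `1` has a continuous argument. -/
theorem continuousOn_arg_div {T : Type*} [TopologicalSpace T] {τ : T → Circle} {G : Set T}
    (hτ : ContinuousOn τ G) (c : Circle) (hc : ∀ t ∈ G, (τ t / c : ℂ) ∈ Complex.slitPlane) :
    ContinuousOn (fun t => (τ t / c : ℂ).arg) G := by
  intro t ht
  have h1 : ContinuousWithinAt (fun t => (τ t / c : ℂ)) G t :=
    (continuous_subtype_val.continuousAt.comp_continuousWithinAt (hτ t ht)).div_const _
  exact ContinuousAt.comp_continuousWithinAt (g := Complex.arg)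
    (Complex.continuousAt_arg (hc t ht)) h1

theorem exp_arg_div (z c : Circle) : Circle.exp (z / c : ℂ).arg = z / c := by
  apply Subtype.ext
  have := Complex.norm_mul_exp_arg_mul_I (z / c : ℂ)
  rw [norm_div, Circle.norm_coe, Circle.norm_coe, div_one, Complex.ofReal_one, one_mul] at this
  rw [Circle.coe_exp, this, Circle.coe_div]

/-- A continuous circle-valued function on the complement of a thin set in a convex open set has
a continuous real lift. -/
theorem IsThin.exists_lift {S D : Set (EuclideanSpace ℝ (Fin d))} (hS : IsThin S)
    (hD : IsOpen D) (hc : Convex ℝ D) {τ : EuclideanSpace ℝ (Fin d) → Circle}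
    (hτ : ContinuousOn τ (D \ S)) :
    ∃ θ : EuclideanSpace ℝ (Fin d) → ℝ, ContinuousOn θ (D \ S) ∧
      ∀ t ∈ D \ S, Circle.exp (θ t) = τ t := by
  rcases (D \ S).eq_empty_or_nonempty with he | ⟨o, ho⟩
  · exact ⟨fun _ => 0, by simp [he], by simp [he]⟩
  -- The candidate lift at `q` is the increment along a broken line from `o` to `q` through `p`. To
  -- compare two choices of `p`, a generic `w` is coned over all four segments: by the four triangle
  -- identities, both increments equal the increment from `w` to `q` minus the one from `w` to `o`.
  have key : ∀ q ∈ D \ S, ∃ a : ℝ, ∀ p, segment ℝ o p ⊆ D \ S → segment ℝ q p ⊆ D \ S →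
      argIncrement τ o p + argIncrement τ p q = a := by
    intro q hq
    obtain ⟨p, hp, h1, h2⟩ := exists_mem_of_ae hD ⟨o, ho.1⟩
      ((hS.ae_segment hc ho).and (hS.ae_segment hc hq))
    refine ⟨argIncrement τ o p + argIncrement τ p q, fun p' h1' h2' => ?_⟩
    obtain ⟨w, hw, ⟨h3, h4⟩, h5, h6⟩ := exists_mem_of_ae hD ⟨o, ho.1⟩
      (((hS.ae_triangle hc (h1 hp)).and (hS.ae_triangle hc (h2 hp))).and
        ((hS.ae_triangle hc h1').and (hS.ae_triangle hc h2')))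
    have e3 := argIncrement_add_of_triangle hτ (h3 hw)
    have e4 := argIncrement_add_of_triangle hτ (h4 hw)
    have e5 := argIncrement_add_of_triangle hτ (h5 hw)
    have e6 := argIncrement_add_of_triangle hτ (h6 hw)
    have s1 := argIncrement_symm (hτ.mono (h2 hp))
    have s2 := argIncrement_symm (hτ.mono h2')
    linarith
  choose! α hα using key
  obtain ⟨θ0, hθ0⟩ := Circle.exp_surjective (τ o)
  refine ⟨fun q => θ0 + α q, fun q hq => ?_, fun q hq => ?_⟩
  · have hq' : ContinuousWithinAt (fun t => (τ t / τ q : ℂ)) (D \ S) q :=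
      (continuous_subtype_val.continuousAt.comp_continuousWithinAt (hτ q hq)).div_const _
    have h1 : (τ q / τ q : ℂ) ∈ Complex.slitPlane := by
      rw [div_self (Circle.coe_ne_zero _)]
      exact Complex.one_mem_slitPlane
    have h2 := hq'.eventually (Complex.isOpen_slitPlane.mem_nhds h1)
    obtain ⟨r, hr, hball⟩ := Metric.mem_nhdsWithin_iff.1 h2
    obtain ⟨r', hr', hball'⟩ := Metric.isOpen_iff.1 hD q hq.1
    set W := Metric.ball q (min r r') with hW
    have hr0 : 0 < min r r' := lt_min hr hr'
    have hWD : W ⊆ D := (Metric.ball_subset_ball (min_le_right _ _)).trans hball'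
    have hqW : q ∈ W := Metric.mem_ball_self hr0
    have hsub : W \ S ⊆ D \ S := Set.sdiff_subset_sdiff_left hWD
    set γ : EuclideanSpace ℝ (Fin d) → ℝ := fun t => (τ t / τ q : ℂ).arg with hγ
    have hγc : ContinuousOn γ (W \ S) := continuousOn_arg_div (hτ.mono hsub) _ fun t ht =>
      hball ⟨Metric.ball_subset_ball (min_le_left _ _) ht.1, hsub ht⟩
    have hWc : Convex ℝ W := convex_ball _ _
    -- Near `q` the principal argument `γ` of `τ / τ q` is already a lift up to a constant. A
    -- generic `p` in `W`, visible from `o`, `q` and `t`, computes both `α q` and `α t`, so their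
    -- difference is an increment of `γ`.
    have heq : ∀ t ∈ W \ S, α t = α q + γ t := by
      intro t ht
      obtain ⟨p, hp, ⟨h3, h4⟩, h5⟩ := exists_mem_of_ae Metric.isOpen_ball ⟨q, hqW⟩
        (((hS.ae_segment hWc ⟨hqW, hq.2⟩).and (hS.ae_segment hWc ht)).and
          (hS.ae_segment hc ho))
      have h3' := h3 hp
      have h4' := h4 hp
      obtain ⟨c0, hc0⟩ := Circle.exp_surjective (τ q)
      have hl : ∀ s ∈ W \ S, Circle.exp (γ s + c0) = τ s := by
        intro s _
        rw [Circle.exp_add, hγ, exp_arg_div, hc0, div_mul_cancel]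
      have hlc : ContinuousOn (fun s => γ s + c0) (W \ S) := hγc.add continuousOn_const
      have e1 := argIncrement_eq hlc hl h3'
      have e2 := argIncrement_eq hlc hl h4'
      have s1 := argIncrement_symm (hτ.mono (h3'.trans hsub))
      have s2 := argIncrement_symm (hτ.mono (h4'.trans hsub))
      have a1 := hα q hq p (h5 (hWD hp)) (h3'.trans hsub)
      have a2 := hα t (hsub ht) p (h5 (hWD hp)) (h4'.trans hsub)
      have hγq : γ q = 0 := by
        simp only [hγ, div_self (Circle.coe_ne_zero (τ q)), Complex.arg_one]
      linarith
    have hmem : W \ S ∈ 𝓝[D \ S] q := by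
      have : D \ S ∩ W ⊆ W \ S := fun x hx => ⟨hx.2, hx.1.2⟩
      exact Filter.mem_of_superset (inter_mem_nhdsWithin _ (Metric.ball_mem_nhds q hr0)) this
    have hcq : ContinuousWithinAt (fun t => θ0 + (α q + γ t)) (W \ S) q :=
      continuousWithinAt_const.add (continuousWithinAt_const.add (hγc q ⟨hqW, hq.2⟩))
    refine (hcq.congr (fun t ht => ?_) ?_).mono_of_mem_nhdsWithin hmem
    · exact congrArg (θ0 + ·) (heq t ht)
    · exact congrArg (θ0 + ·) (heq q ⟨hqW, hq.2⟩)
  · obtain ⟨p, hp, h1, h2⟩ := exists_mem_of_ae hD ⟨o, ho.1⟩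
      ((hS.ae_segment hc ho).and (hS.ae_segment hc hq))
    change Circle.exp (θ0 + α q) = τ q
    rw [← hα q hq p (h1 hp) (h2 hp)]
    have e1 := exp_argIncrement (hτ.mono (h1 hp))
    have e2 := exp_argIncrement (x := p) (y := q) (hτ.mono (by rw [segment_symm]; exact h2 hp))
    rw [e2, e1, Circle.exp_add, Circle.exp_add, hθ0, mul_assoc]

end Thin

/-! ### Sets of codimension three are thin in charts -/

section Codim

open MeasureTheory Module

variable {d : ℕ}

theorem IsThin.mono {S T : Set (EuclideanSpace ℝ (Fin d))} (hT : IsThin T) (h : S ⊆ T) :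
    IsThin S := by
  intro q r
  filter_upwards [hT q r] with p hp a b c ha habc hS
  exact hp a b c ha habc (h hS)

theorem isThin_iUnion {ι : Type*} [Countable ι] {S : ι → Set (EuclideanSpace ℝ (Fin d))}
    (hS : ∀ i, IsThin (S i)) : IsThin (⋃ i, S i) := by
  intro q r
  filter_upwards [ae_all_iff.2 fun i => hS i q r] with p hp a b c ha habc h
  obtain ⟨i, hi⟩ := Set.mem_iUnion.1 h
  exact hp i a b c ha habc hi

/-- A `C¹` map is locally Lipschitz, so it does not raise Hausdorff dimension. -/
theorem dimH_image_le_finrank {E F : Type*} [NormedAddCommGroup E] [NormedSpace ℝ E]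
    [FiniteDimensional ℝ E] [NormedAddCommGroup F] [NormedSpace ℝ F] {f : E → F} {O : Set E}
    (hO : IsOpen O) (hf : ContDiffOn ℝ 1 f O) : dimH (f '' O) ≤ finrank ℝ E := by
  refine (dimH_image_le_of_locally_lipschitzOn fun x hx => ?_).trans
    ((dimH_mono (Set.subset_univ O)).trans (Real.dimH_univ_eq_finrank E).le)
  obtain ⟨C, t, ht, h⟩ := (hf.contDiffAt (hO.mem_nhds hx)).exists_lipschitzOnWith
  exact ⟨C, t, mem_nhdsWithin_of_mem_nhds ht, h⟩

theorem volume_eq_zero_of_dimH_lt {A : Set (EuclideanSpace ℝ (Fin d))} (h : dimH A < d) :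
    volume A = 0 := by
  have hH : Measure.IsAddHaarMeasure
      (μH[finrank ℝ (EuclideanSpace ℝ (Fin d))] : Measure (EuclideanSpace ℝ (Fin d))) :=
    isAddHaarMeasure_hausdorffMeasure
  simp only [finrank_euclideanSpace_fin] at hH
  refine measure_zero_of_dimH_lt (d := (d : NNReal)) ?_ (by simpa using h)
  simp only [NNReal.coe_natCast]
  exact Measure.absolutelyContinuous_isAddHaarMeasure _ _

/-- This is where codimension three enters. A bad apex satisfies `a p + b q + c r = h z` with `a = 1
- b - c > 0`, so it can be solved for as a `C¹` function of `(z, b, c)`. These parameters have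
dimension `m + 2 < d`, so the bad apexes form a null set. -/
theorem isThin_image {m : ℕ} (hm : m + 3 ≤ d)
    {h : EuclideanSpace ℝ (Fin m) → EuclideanSpace ℝ (Fin d)}
    {O : Set (EuclideanSpace ℝ (Fin m))} (hO : IsOpen O) (hh : ContDiffOn ℝ 1 h O) :
    IsThin (h '' O) := by
  intro q r
  let H : EuclideanSpace ℝ (Fin m) × (ℝ × ℝ) → EuclideanSpace ℝ (Fin d) := fun z =>
    (1 - z.2.1 - z.2.2)⁻¹ • (h z.1 - z.2.1 • q - z.2.2 • r)
  let U : Set (EuclideanSpace ℝ (Fin m) × (ℝ × ℝ)) :=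
    {z | z.1 ∈ O} ∩ {z | 1 - z.2.1 - z.2.2 ≠ 0}
  have hU : IsOpen U := by
    refine (hO.preimage continuous_fst).inter (isOpen_ne.preimage ?_)
    fun_prop
  have hH : ContDiffOn ℝ 1 H U := by
    have h1 : ContDiffOn ℝ 1 (fun z : EuclideanSpace ℝ (Fin m) × (ℝ × ℝ) => h z.1) U :=
      hh.comp contDiff_fst.contDiffOn fun z hz => hz.1
    have h2 : ContDiffOn ℝ 1 (fun z : EuclideanSpace ℝ (Fin m) × (ℝ × ℝ) =>
        (1 - z.2.1 - z.2.2)⁻¹) U := by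
      refine ContDiffOn.inv ?_ fun z hz => hz.2
      fun_prop
    refine h2.smul ((h1.sub ?_).sub ?_)
    · exact ContDiff.contDiffOn (by fun_prop)
    · exact ContDiff.contDiffOn (by fun_prop)
  have hdim : dimH (H '' U) < d := by
    refine (dimH_image_le_finrank hU hH).trans_lt ?_
    have : finrank ℝ (EuclideanSpace ℝ (Fin m) × (ℝ × ℝ)) = m + 2 := by simp
    rw [this]
    exact_mod_cast (by omega : m + 2 < d)
  refine measure_mono_null ?_ (volume_eq_zero_of_dimH_lt hdim)
  intro p hp
  simp only [Set.mem_compl_iff, Set.mem_ofPred_eq, not_forall, not_not] at hp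
  obtain ⟨a, b, c, ha, habc, z, hz, hzp⟩ := hp
  have h1 : 1 - b - c = a := by linarith
  refine ⟨(z, b, c), ⟨hz, ?_⟩, ?_⟩
  · simp only [Set.mem_ofPred_eq, h1]
    exact ha.ne'
  · simp only [H, h1, hzp]
    rw [inv_smul_eq_iff₀ ha.ne']
    abel

variable {n : ℕ} {X : Type u} [TopologicalSpace X]
  [ChartedSpace (EuclideanSpace ℝ (Fin (2 * n))) X] [IsManifold (𝓡 (2 * n)) ∞ X]

/-- In a chart, a set of codimension at least `3` is thin. -/
theorem HasCodimAtLeast.isThin {S : Set X} (hS : HasCodimAtLeast n S 3) (x : X) :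
    IsThin ((extChartAt (𝓡 (2 * n)) x).target ∩ (extChartAt (𝓡 (2 * n)) x).symm ⁻¹' S) := by
  obtain ⟨ι, hι, m, M, t1, t2, g, hg, hSg⟩ := hS
  have key : ∀ i, IsThin (extChartAt (𝓡 (2 * n)) x '' (Set.range (g i) ∩
      (extChartAt (𝓡 (2 * n)) x).source)) := by
    intro i
    obtain ⟨ht2, hsc, hman, hdim, hsm⟩ := hg i
    -- Second countability of `M i` leaves countably many charts, on each of which `isThin_image`
    -- applies to the coordinate expression of `g i`.
    obtain ⟨s, hsc, hs⟩ := TopologicalSpace.countable_cover_nhds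
      (fun y : M i => extChartAt_source_mem_nhds (I := 𝓡 (m i)) y)
    have := hsc.to_subtype
    have h2 := (contMDiff_iff.1 hsm).2
    refine (isThin_iUnion (ι := s) fun y => isThin_image hdim
      (O := (extChartAt (𝓡 (m i)) (y : M i)).target ∩
        (extChartAt (𝓡 (m i)) (y : M i)).symm ⁻¹' (g i ⁻¹' (extChartAt (𝓡 (2 * n)) x).source))
      (h := extChartAt (𝓡 (2 * n)) x ∘ g i ∘ (extChartAt (𝓡 (m i)) (y : M i)).symm) ?_
      ((h2 y x).of_le (by simp))).mono ?_
    · exact (continuousOn_extChartAt_symm (y : M i)).isOpen_inter_preimage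
        (isOpen_extChartAt_target (y : M i))
        ((isOpen_extChartAt_source x).preimage hsm.continuous)
    · rintro _ ⟨_, ⟨⟨z, rfl⟩, hz⟩, rfl⟩
      have hzU : z ∈ ⋃ y ∈ s, (extChartAt (𝓡 (m i)) y).source := hs ▸ Set.mem_univ z
      obtain ⟨y, hy, hzy⟩ := Set.mem_iUnion₂.1 hzU
      refine Set.mem_iUnion.2 ⟨⟨y, hy⟩, extChartAt (𝓡 (m i)) y z, ⟨?_, ?_⟩, ?_⟩
      · exact (extChartAt (𝓡 (m i)) y).map_source hzy
      · rwa [Set.mem_preimage, Set.mem_preimage, (extChartAt (𝓡 (m i)) y).left_inv hzy]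
      · rw [Function.comp_apply, Function.comp_apply, (extChartAt (𝓡 (m i)) y).left_inv hzy]
  refine (isThin_iUnion key).mono ?_
  rintro y ⟨hy, hyS⟩
  obtain ⟨i, hi⟩ := Set.mem_iUnion.1 (hSg hyS)
  exact Set.mem_iUnion.2 ⟨i, (extChartAt (𝓡 (2 * n)) x).symm y,
    ⟨hi, (extChartAt (𝓡 (2 * n)) x).map_target hy⟩, (extChartAt (𝓡 (2 * n)) x).right_inv hy⟩

/-- With coefficients `1, 0, 0`, thinness says that almost every point of a chart itself avoids `S`.
-/
theorem HasCodimAtLeast.dense_compl {S : Set X} (hS : HasCodimAtLeast n S 3) : Dense Sᶜ := by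
  intro x
  rw [mem_closure_iff_nhds]
  intro N hN
  set φ := extChartAt (𝓡 (2 * n)) x with hφ
  have hx : φ x ∈ φ.target := mem_extChartAt_target x
  have hU : φ.target ∩ φ.symm ⁻¹' (interior N) ∈ 𝓝 (φ x) :=
    Filter.inter_mem (extChartAt_target_mem_nhds x) (by
      refine (continuousAt_extChartAt_symm x).preimage_mem_nhds ?_
      rw [extChartAt_to_inv]
      exact interior_mem_nhds.2 hN)
  obtain ⟨y, hy, h⟩ := exists_mem_of_ae isOpen_interior ⟨φ x, mem_interior_iff_mem_nhds.2 hU⟩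
    (hS.isThin x 0 0)
  have hy' := interior_subset hy
  refine ⟨φ.symm y, interior_subset hy'.2, fun hyS => ?_⟩
  exact h 1 0 0 one_pos (by norm_num) (by simpa using ⟨by simpa [φ] using hy'.1, hyS⟩)

/-- Every point has arbitrarily small open neighbourhoods whose part outside a set of codimension
at least `3` is connected and admits logarithms of circle-valued functions. -/
theorem HasCodimAtLeast.exists_nhds {S : Set X} (hS : HasCodimAtLeast n S 3) {x : X} {N : Set X}
    (hN : N ∈ 𝓝 x) :
    ∃ V : Set X, IsOpen V ∧ x ∈ V ∧ V ⊆ N ∧ IsPreconnected (V ∩ Sᶜ) ∧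
      ∀ τ : X → Circle, ContinuousOn τ (V ∩ Sᶜ) →
        ∃ θ : X → ℝ, ContinuousOn θ (V ∩ Sᶜ) ∧ ∀ y ∈ V ∩ Sᶜ, Circle.exp (θ y) = τ y := by
  set φ := extChartAt (𝓡 (2 * n)) x with hφ
  have hU : φ.target ∩ φ.symm ⁻¹' N ∈ 𝓝 (φ x) :=
    Filter.inter_mem (extChartAt_target_mem_nhds x) (by
      refine (continuousAt_extChartAt_symm x).preimage_mem_nhds ?_
      rwa [extChartAt_to_inv])
  obtain ⟨r, hr, hball⟩ := Metric.mem_nhds_iff.1 hU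
  set D := Metric.ball (φ x) r with hD
  have hT := hS.isThin x
  rw [← hφ] at hT
  set T := φ.target ∩ φ.symm ⁻¹' S
  have hsymm : ∀ y ∈ D \ T, φ.symm y ∈ (φ.source ∩ φ ⁻¹' D) ∩ Sᶜ := fun y hy => by
    have hyt := (hball hy.1).1
    exact ⟨⟨φ.map_target hyt, by simpa [φ.right_inv hyt] using hy.1⟩, fun h => hy.2 ⟨hyt, h⟩⟩
  have hto : ∀ y ∈ (φ.source ∩ φ ⁻¹' D) ∩ Sᶜ, φ y ∈ D \ T := fun y hy =>
    ⟨hy.1.2, fun h => hy.2 (by simpa [φ.left_inv hy.1.1] using h.2)⟩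
  have hcs : ContinuousOn φ.symm (D \ T) :=
    (continuousOn_extChartAt_symm x).mono fun y hy => (hball hy.1).1
  have hct : ContinuousOn φ ((φ.source ∩ φ ⁻¹' D) ∩ Sᶜ) :=
    (continuousOn_extChartAt x).mono fun y hy => hy.1.1
  refine ⟨φ.source ∩ φ ⁻¹' D, ?_, ⟨mem_extChartAt_source x, Metric.mem_ball_self hr⟩, ?_, ?_, ?_⟩
  · exact (continuousOn_extChartAt x).isOpen_inter_preimage (isOpen_extChartAt_source x)
      Metric.isOpen_ball
  · rintro y ⟨hy, hyD⟩
    have := (hball hyD).2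
    rwa [Set.mem_preimage, φ.left_inv hy] at this
  · have := (hT.isPreconnected Metric.isOpen_ball (convex_ball _ _)).image _ hcs
    convert this using 1
    ext y
    constructor
    · intro hy
      exact ⟨φ y, hto y hy, φ.left_inv hy.1.1⟩
    · rintro ⟨z, hz, rfl⟩
      exact hsymm z hz
  · intro τ hτ
    obtain ⟨θ, hθ, h⟩ := hT.exists_lift Metric.isOpen_ball (convex_ball _ _)
      (hτ.comp hcs hsymm)
    refine ⟨θ ∘ φ, hθ.comp hct hto, fun y hy => ?_⟩
    have := h (φ y) (hto y hy)
    rwa [Function.comp_apply, φ.left_inv hy.1.1] at this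

end Codim

/-! ### Complex frames of the tangent spaces -/

section Frames

open Module

variable {n : ℕ} {X : Type u} [TopologicalSpace X]
  [ChartedSpace (EuclideanSpace ℝ (Fin (2 * n))) X]

theorem finrank_tan (x : X) : finrank ℝ (Tan n x) = 2 * n :=
  finrank_euclideanSpace_fin

variable [IsManifold (𝓡 (2 * n)) ∞ X] {Ω : SymplecticForm n X} (J : CompatibleACS Ω) {x : X}

instance (x : X) : FiniteDimensional ℝ (Tan n x) :=
  inferInstanceAs (FiniteDimensional ℝ (EuclideanSpace ℝ (Fin (2 * n))))

/-- The complex linear combination `∑ i, c i • v i` in `(T_x X, J)`. -/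
def comb (v : Fin n → Tan n x) (c : Fin n → ℂ) : Tan n x :=
  ∑ i, ((c i).re • v i + (c i).im • J.J x (v i))

/-- The vectors `v · A`. -/
def act (v : Fin n → Tan n x) (A : Matrix (Fin n) (Fin n) ℂ) : Fin n → Tan n x :=
  fun j => comb J v fun i => A i j

theorem isTransition_iff {v w : Fin n → Tan n x} {A : Matrix (Fin n) (Fin n) ℂ} :
    IsTransition J x v w A ↔ w = act J v A :=
  funext_iff.symm

theorem comb_add (v : Fin n → Tan n x) (c c' : Fin n → ℂ) :
    comb J v (c + c') = comb J v c + comb J v c' := by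
  simp only [comb, ← Finset.sum_add_distrib]
  refine Finset.sum_congr rfl fun i _ => ?_
  simp only [Pi.add_apply, Complex.add_re, Complex.add_im]
  module

theorem comb_smul (v : Fin n → Tan n x) (r : ℝ) (c : Fin n → ℂ) :
    comb J v (r • c) = r • comb J v c := by
  simp only [comb, Finset.smul_sum]
  refine Finset.sum_congr rfl fun i _ => ?_
  simp only [Pi.smul_apply, Complex.smul_re, Complex.smul_im, smul_eq_mul]
  module

/-- `comb` as a real linear map. -/
def combL (v : Fin n → Tan n x) : (Fin n → ℂ) →ₗ[ℝ] Tan n x where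
  toFun := comb J v
  map_add' := comb_add J v
  map_smul' := comb_smul J v

theorem combL_apply (v : Fin n → Tan n x) (c : Fin n → ℂ) : combL J v c = comb J v c := rfl

theorem comb_act (v : Fin n → Tan n x) (A : Matrix (Fin n) (Fin n) ℂ) (c : Fin n → ℂ) :
    comb J (act J v A) c = comb J v (A.mulVec c) := by
  have h1 : ∀ j, (c j).re • act J v A j + (c j).im • J.J x (act J v A j) =
      ∑ i, ((A i j * c j).re • v i + (A i j * c j).im • J.J x (v i)) := by
    intro j
    simp only [act, comb, map_sum, map_add, map_smul, J.sq, Finset.smul_sum,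
      ← Finset.sum_add_distrib]
    refine Finset.sum_congr rfl fun i _ => ?_
    rw [Complex.mul_re, Complex.mul_im]
    module
  rw [comb, Finset.sum_congr rfl fun j _ => h1 j, Finset.sum_comm, comb]
  refine Finset.sum_congr rfl fun i _ => ?_
  simp only [Matrix.mulVec, dotProduct, Complex.re_sum, Complex.im_sum, Finset.sum_smul,
    Finset.sum_add_distrib]

theorem act_act (v : Fin n → Tan n x) (A B : Matrix (Fin n) (Fin n) ℂ) :
    act J (act J v A) B = act J v (A * B) := by
  funext j
  rw [act, comb_act]
  rfl

theorem act_one (v : Fin n → Tan n x) : act J v 1 = v := by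
  funext j
  simp only [act, comb]
  rw [Finset.sum_eq_single j]
  · simp
  · intro i _ hij
    simp [Matrix.one_apply_ne hij]
  · simp

theorem isComplexFrame_iff_injective {v : Fin n → Tan n x} :
    IsComplexFrame J x v ↔ Function.Injective (combL J v) := by
  rw [IsComplexFrame, Fintype.linearIndependent_iff, ← LinearMap.ker_eq_bot, LinearMap.ker_eq_bot']
  constructor
  · intro h c hc
    have := h (Sum.elim (fun i => (c i).re) fun i => (c i).im) (by
      rw [Fintype.sum_sum_type, ← Finset.sum_add_distrib]
      simpa [combL_apply, comb] using hc)
    funext i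
    exact Complex.ext (by simpa using this (Sum.inl i)) (by simpa using this (Sum.inr i))
  · intro h g hg
    have := h (fun i => ⟨g (Sum.inl i), g (Sum.inr i)⟩) (by
      rw [Fintype.sum_sum_type, ← Finset.sum_add_distrib] at hg
      simpa [combL_apply, comb] using hg)
    rintro (i | i)
    · simpa using congrArg Complex.re (congrFun this i)
    · simpa using congrArg Complex.im (congrFun this i)

variable {J}

theorem IsComplexFrame.comb_injective {v : Fin n → Tan n x} (hv : IsComplexFrame J x v) :
    Function.Injective (comb J v) :=
  (isComplexFrame_iff_injective J).1 hv

theorem IsComplexFrame.comb_surjective {v : Fin n → Tan n x} (hv : IsComplexFrame J x v) :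
    Function.Surjective (comb J v) := by
  refine (LinearMap.injective_iff_surjective_of_finrank_eq_finrank ?_).1
    ((isComplexFrame_iff_injective J).1 hv)
  rw [finrank_tan, Module.finrank_pi_fintype]
  simp [Complex.finrank_real_complex, mul_comm]

theorem IsComplexFrame.exists_eq_act {v : Fin n → Tan n x} (hv : IsComplexFrame J x v)
    (w : Fin n → Tan n x) : ∃ A, w = act J v A := by
  choose c hc using fun j => hv.comb_surjective (w j)
  exact ⟨Matrix.of fun i j => c j i, funext fun j => (hc j).symm⟩

theorem IsComplexFrame.act_injective {v : Fin n → Tan n x} (hv : IsComplexFrame J x v) :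
    Function.Injective (act J v) := by
  intro A B h
  ext i j
  exact congrFun (hv.comb_injective (congrFun h j)) i

theorem IsComplexFrame.act_iff {v : Fin n → Tan n x} (hv : IsComplexFrame J x v)
    {A : Matrix (Fin n) (Fin n) ℂ} : IsComplexFrame J x (act J v A) ↔ A.det ≠ 0 := by
  constructor
  · intro h
    obtain ⟨B, hB⟩ := h.exists_eq_act v
    rw [act_act] at hB
    have : A * B = 1 := hv.act_injective (by rw [← hB, act_one])
    exact fun h0 => by simpa [h0] using congrArg Matrix.det this
  · intro h
    rw [isComplexFrame_iff_injective]
    intro c c' hc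
    simp only [combL_apply, comb_act] at hc
    exact Matrix.mulVec_injective_of_isUnit ((Matrix.isUnit_iff_isUnit_det _).2 h.isUnit)
      (hv.comb_injective hc)

variable (J) in
open Classical in
/-- The matrix expressing `w` through the complex frame `v`. -/
def transMat (v w : Fin n → Tan n x) : Matrix (Fin n) (Fin n) ℂ :=
  if h : ∃ A, w = act J v A then h.choose else 0

theorem IsComplexFrame.act_transMat {v : Fin n → Tan n x} (hv : IsComplexFrame J x v)
    (w : Fin n → Tan n x) : act J v (transMat J v w) = w := by
  have h := hv.exists_eq_act w
  rw [transMat, dif_pos h]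
  exact h.choose_spec.symm

theorem IsComplexFrame.isTransition {v : Fin n → Tan n x} (hv : IsComplexFrame J x v)
    (w : Fin n → Tan n x) : IsTransition J x v w (transMat J v w) :=
  (isTransition_iff J).2 (hv.act_transMat w).symm

theorem IsComplexFrame.transMat_act {v : Fin n → Tan n x} (hv : IsComplexFrame J x v)
    (A : Matrix (Fin n) (Fin n) ℂ) : transMat J v (act J v A) = A :=
  hv.act_injective (hv.act_transMat _)

theorem IsComplexFrame.transMat_eq {v w : Fin n → Tan n x} (hv : IsComplexFrame J x v)
    {A : Matrix (Fin n) (Fin n) ℂ} (h : IsTransition J x v w A) : transMat J v w = A := by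
  rw [(isTransition_iff J).1 h, hv.transMat_act]

theorem IsComplexFrame.transMat_mul {v w : Fin n → Tan n x} (hv : IsComplexFrame J x v)
    (hw : IsComplexFrame J x w) (z : Fin n → Tan n x) :
    transMat J v w * transMat J w z = transMat J v z := by
  apply hv.act_injective
  rw [← act_act, hv.act_transMat, hw.act_transMat, hv.act_transMat]

theorem IsComplexFrame.det_transMat_ne_zero {v w : Fin n → Tan n x} (hv : IsComplexFrame J x v)
    (hw : IsComplexFrame J x w) : (transMat J v w).det ≠ 0 := by
  rw [← hv.act_iff, hv.act_transMat]
  exact hw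

variable (J) in
/-- The complex vector space structure on the tangent space. -/
@[reducible]
def complexModule (x : X) : Module ℂ (Tan n x) where
  smul z a := z.re • a + z.im • J.J x a
  one_smul a := by
    change (1 : ℂ).re • a + (1 : ℂ).im • J.J x a = a
    simp
  mul_smul z w a := by
    change (z * w).re • a + (z * w).im • J.J x a =
      z.re • (w.re • a + w.im • J.J x a) + z.im • J.J x (w.re • a + w.im • J.J x a)
    simp only [map_add, map_smul, J.sq, Complex.mul_re, Complex.mul_im]
    module
  smul_zero z := by
    change z.re • (0 : Tan n x) + z.im • J.J x 0 = 0
    simp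
  smul_add z a b := by
    change z.re • (a + b) + z.im • J.J x (a + b) =
      z.re • a + z.im • J.J x a + (z.re • b + z.im • J.J x b)
    simp only [map_add]
    module
  add_smul z w a := by
    change (z + w).re • a + (z + w).im • J.J x a =
      z.re • a + z.im • J.J x a + (w.re • a + w.im • J.J x a)
    simp only [Complex.add_re, Complex.add_im]
    module
  zero_smul a := by
    change (0 : ℂ).re • a + (0 : ℂ).im • J.J x a = 0
    simp

variable (J) in
theorem exists_isComplexFrame (x : X) : ∃ v : Fin n → Tan n x, IsComplexFrame J x v := by
  let _ := complexModule J x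
  have hsmul : ∀ (z : ℂ) (a : Tan n x), z • a = z.re • a + z.im • J.J x a := fun _ _ => rfl
  have htower : IsScalarTower ℝ ℂ (Tan n x) := ⟨fun r z a => by
    simp only [hsmul, Complex.smul_re, Complex.smul_im, smul_eq_mul]
    module⟩
  have hfin : FiniteDimensional ℂ (Tan n x) := FiniteDimensional.right ℝ ℂ _
  have hrank : finrank ℂ (Tan n x) = n := by
    have := finrank_mul_finrank ℝ ℂ (Tan n x)
    rw [finrank_tan, Complex.finrank_real_complex] at this
    omega
  let b := finBasisOfFinrankEq ℂ (Tan n x) hrank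
  refine ⟨b, ?_⟩
  rw [isComplexFrame_iff_injective, ← LinearMap.ker_eq_bot, LinearMap.ker_eq_bot']
  intro c hc
  funext i
  exact Fintype.linearIndependent_iff.1 b.linearIndependent c hc i

end Frames

/-! ### Continuity of vector fields along maps -/

section Sections

open Module

variable {n : ℕ} {X : Type u} [TopologicalSpace X]
  [ChartedSpace (EuclideanSpace ℝ (Fin (2 * n))) X] [IsManifold (𝓡 (2 * n)) ∞ X]
  {Ω : SymplecticForm n X} (J : CompatibleACS Ω)
  {Z : Type*} [TopologicalSpace Z] {σ : Z → X} {s : Set Z} {t₀ : Z}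

/-- The preferred trivialization of the tangent bundle near `x₀`, on the fiber over `y`. -/
def triv (x₀ y : X) : Tan n y →L[ℝ] EuclideanSpace ℝ (Fin (2 * n)) :=
  (trivializationAt (EuclideanSpace ℝ (Fin (2 * n))) (TangentSpace (𝓡 (2 * n)))
    x₀).continuousLinearMapAt ℝ y

theorem eventually_mem_baseSet (x₀ : X) :
    ∀ᶠ y in 𝓝 x₀, y ∈ (trivializationAt (EuclideanSpace ℝ (Fin (2 * n)))
      (TangentSpace (𝓡 (2 * n))) x₀).baseSet :=
  (trivializationAt (EuclideanSpace ℝ (Fin (2 * n)))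
    (TangentSpace (𝓡 (2 * n))) x₀).open_baseSet.mem_nhds (FiberBundle.mem_baseSet_trivializationAt' x₀)

theorem triv_bijective {x₀ y : X} (hy : y ∈ (trivializationAt (EuclideanSpace ℝ (Fin (2 * n)))
      (TangentSpace (𝓡 (2 * n))) x₀).baseSet) : Function.Bijective (triv (n := n) x₀ y) := by
  rw [triv, ← Bundle.Trivialization.coe_continuousLinearEquivAt_eq _ hy]
  exact ContinuousLinearEquiv.bijective _

theorem continuousWithinAt_section_iff {v : ∀ t, Tan n (σ t)}
    (hσ : ContinuousWithinAt σ s t₀) :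
    ContinuousWithinAt (fun t => (⟨σ t, v t⟩ : TanBundle n X)) s t₀ ↔
      ContinuousWithinAt (fun t => triv (σ t₀) (σ t) (v t)) s t₀ := by
  have h : ∀ y ∈ (trivializationAt (EuclideanSpace ℝ (Fin (2 * n)))
      (TangentSpace (𝓡 (2 * n))) (σ t₀)).baseSet, ∀ a : Tan n y,
      triv (σ t₀) y a = (trivializationAt (EuclideanSpace ℝ (Fin (2 * n)))
      (TangentSpace (𝓡 (2 * n))) (σ t₀) ⟨y, a⟩).2 := fun y hy a =>
    Bundle.Trivialization.continuousLinearMapAt_apply_of_mem (R := ℝ) _ hy a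
  rw [FiberBundle.continuousWithinAt_totalSpace]
  simp only [hσ, true_and]
  refine Filter.EventuallyEq.congr_continuousWithinAt ?_ ?_
  · filter_upwards [hσ.eventually (eventually_mem_baseSet (n := n) (σ t₀))] with t ht
    exact (h _ ht _).symm
  · exact (h _ (FiberBundle.mem_baseSet_trivializationAt' _) _).symm

theorem continuousWithinAt_J {v : ∀ t, Tan n (σ t)}
    (h : ContinuousWithinAt (fun t => (⟨σ t, v t⟩ : TanBundle n X)) s t₀) :
    ContinuousWithinAt (fun t => (⟨σ t, J.J (σ t) (v t)⟩ : TanBundle n X)) s t₀ := by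
  have hσ : ContinuousWithinAt σ s t₀ := ((FiberBundle.continuousWithinAt_totalSpace _ _).1 h).1
  exact ContinuousWithinAt.clm_bundle_apply (b := σ) (ϕ := fun t => J.J (σ t)) (v := v)
    (J.smooth.continuous.continuousAt.comp_continuousWithinAt hσ) h

theorem continuousWithinAt_comb {v : ∀ t, Fin n → Tan n (σ t)} {c : Z → Fin n → ℂ}
    (hσ : ContinuousWithinAt σ s t₀)
    (h : ∀ i, ContinuousWithinAt (fun t => (⟨σ t, v t i⟩ : TanBundle n X)) s t₀)
    (hc : ∀ i, ContinuousWithinAt (fun t => c t i) s t₀) :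
    ContinuousWithinAt (fun t => (⟨σ t, comb J (v t) (c t)⟩ : TanBundle n X)) s t₀ := by
  rw [continuousWithinAt_section_iff hσ]
  simp only [comb, map_sum, map_add, map_smul]
  refine tendsto_finsetSum _ fun i _ => ?_
  have h1 := (continuousWithinAt_section_iff hσ).1 (h i)
  have h2 := (continuousWithinAt_section_iff hσ).1 (continuousWithinAt_J J (h i))
  exact ((Complex.continuous_re.continuousAt.comp_continuousWithinAt (hc i)).smul h1).add
    ((Complex.continuous_im.continuousAt.comp_continuousWithinAt (hc i)).smul h2)

/-- The complex linear combinations of `v`, read in the preferred trivialization near `x₀`. -/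
def frameMap (x₀ : X) {y : X} (v : Fin n → Tan n y) :
    (Fin n → ℂ) →L[ℝ] EuclideanSpace ℝ (Fin (2 * n)) :=
  ∑ i, ((Complex.reCLM.comp (ContinuousLinearMap.proj (R := ℝ) i)).smulRight (triv x₀ y (v i)) +
    (Complex.imCLM.comp (ContinuousLinearMap.proj (R := ℝ) i)).smulRight
      (triv x₀ y (J.J y (v i))))

theorem frameMap_apply (x₀ : X) {y : X} (v : Fin n → Tan n y) (c : Fin n → ℂ) :
    frameMap J x₀ v c = triv x₀ y (comb J v c) := by
  simp [frameMap, comb]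

theorem continuousWithinAt_frameMap {v : ∀ t, Fin n → Tan n (σ t)}
    (hσ : ContinuousWithinAt σ s t₀)
    (h : ∀ i, ContinuousWithinAt (fun t => (⟨σ t, v t i⟩ : TanBundle n X)) s t₀) :
    ContinuousWithinAt (fun t => frameMap J (σ t₀) (v t)) s t₀ := by
  refine tendsto_finsetSum _ fun i _ => ?_
  have h1 := (continuousWithinAt_section_iff hσ).1 (h i)
  have h2 := (continuousWithinAt_section_iff hσ).1 (continuousWithinAt_J J (h i))
  exact (((ContinuousLinearMap.smulRightL ℝ (Fin n → ℂ) (EuclideanSpace ℝ (Fin (2 * n)))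
      (Complex.reCLM.comp (ContinuousLinearMap.proj (R := ℝ) i))).continuous.continuousAt
      ).comp_continuousWithinAt h1).add
    (((ContinuousLinearMap.smulRightL ℝ (Fin n → ℂ) (EuclideanSpace ℝ (Fin (2 * n)))
      (Complex.imCLM.comp (ContinuousLinearMap.proj (R := ℝ) i))).continuous.continuousAt
      ).comp_continuousWithinAt h2)

theorem continuousAt_inverse_of_isInvertible {E F : Type*} [NormedAddCommGroup E] [NormedSpace ℝ E]
    [CompleteSpace E] [NormedAddCommGroup F] [NormedSpace ℝ F] {f : E →L[ℝ] F}
    (hf : f.IsInvertible) : ContinuousAt ContinuousLinearMap.inverse f := by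
  obtain ⟨e, rfl⟩ := hf
  exact (contDiffAt_map_inverse (n := 0) e).continuousAt

variable {J}

theorem IsComplexFrame.isInvertible_frameMap {x₀ y : X} {v : Fin n → Tan n y}
    (hv : IsComplexFrame J y v) (hy : y ∈ (trivializationAt (EuclideanSpace ℝ (Fin (2 * n)))
      (TangentSpace (𝓡 (2 * n))) x₀).baseSet) : (frameMap J x₀ v).IsInvertible := by
  have hb : Function.Bijective (frameMap J x₀ v) := by
    have h1 : ⇑(frameMap J x₀ v) = triv x₀ y ∘ comb J v := funext (frameMap_apply J x₀ v)
    rw [h1]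
    exact (triv_bijective hy).comp ⟨hv.comb_injective, hv.comb_surjective⟩
  exact ⟨(LinearEquiv.ofBijective (frameMap J x₀ v).toLinearMap hb).toContinuousLinearEquiv,
    by ext; rfl⟩

/-- In a trivialization a complex frame is an invertible operator `frameMap`, and invertible
operators form an open set. -/
theorem IsComplexFrame.eventually {v : ∀ t, Fin n → Tan n (σ t)}
    (hσ : ContinuousWithinAt σ s t₀)
    (h : ∀ i, ContinuousWithinAt (fun t => (⟨σ t, v t i⟩ : TanBundle n X)) s t₀)
    (h0 : IsComplexFrame J (σ t₀) (v t₀)) : ∀ᶠ t in 𝓝[s] t₀, IsComplexFrame J (σ t) (v t) := by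
  obtain ⟨e, he⟩ := h0.isInvertible_frameMap (FiberBundle.mem_baseSet_trivializationAt' (σ t₀))
  have hn := e.nhds
  rw [he] at hn
  have h1 := (continuousWithinAt_frameMap J hσ h).eventually hn
  filter_upwards [h1] with t ⟨e', he'⟩
  rw [isComplexFrame_iff_injective]
  intro c c' hc
  apply e'.injective
  have h2 : ∀ c, e' c = triv (σ t₀) (σ t) (comb J (v t) c) := fun c => by
    rw [← frameMap_apply, ← he']; rfl
  rw [h2, h2]
  exact congrArg _ hc

theorem continuousWithinAt_matrix_iff {m : Type*} {A : Z → Matrix m m ℂ} :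
    ContinuousWithinAt A s t₀ ↔ ∀ i j, ContinuousWithinAt (fun t => A t i j) s t₀ :=
  continuousWithinAt_pi.trans (forall_congr' fun _ => continuousWithinAt_pi)

/-- The columns of the transition matrix are obtained by applying the inverse of `frameMap` to the
vectors of `w`, and operator inversion is continuous at an invertible operator. -/
theorem continuousWithinAt_transMat {v w : ∀ t, Fin n → Tan n (σ t)}
    (hσ : ContinuousWithinAt σ s t₀)
    (hv : ∀ i, ContinuousWithinAt (fun t => (⟨σ t, v t i⟩ : TanBundle n X)) s t₀)
    (hw : ∀ i, ContinuousWithinAt (fun t => (⟨σ t, w t i⟩ : TanBundle n X)) s t₀)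
    (h0 : IsComplexFrame J (σ t₀) (v t₀)) :
    ContinuousWithinAt (fun t => transMat J (v t) (w t)) s t₀ := by
  have hinv : ContinuousWithinAt (fun t => (frameMap J (σ t₀) (v t)).inverse) s t₀ := by
    have h1 := continuousAt_inverse_of_isInvertible
      (h0.isInvertible_frameMap (FiberBundle.mem_baseSet_trivializationAt' (σ t₀)))
    have h2 := continuousWithinAt_frameMap J hσ hv

    exact Filter.Tendsto.comp h1 h2
  refine continuousWithinAt_matrix_iff.2 fun i j => ?_
  have h2 : ContinuousWithinAt (fun t => (frameMap J (σ t₀) (v t)).inverse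
      (triv (σ t₀) (σ t) (w t j)) i) s t₀ :=
    (continuous_apply i).continuousAt.comp_continuousWithinAt
      (hinv.clm_apply ((continuousWithinAt_section_iff hσ).1 (hw j)))
  have h3 : ∀ t, IsComplexFrame J (σ t) (v t) → σ t ∈ (trivializationAt
      (EuclideanSpace ℝ (Fin (2 * n))) (TangentSpace (𝓡 (2 * n))) (σ t₀)).baseSet →
      transMat J (v t) (w t) i j = (frameMap J (σ t₀) (v t)).inverse
        (triv (σ t₀) (σ t) (w t j)) i := by
    intro t ht hb
    have h4 : triv (σ t₀) (σ t) (w t j) =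
        frameMap J (σ t₀) (v t) (fun i => transMat J (v t) (w t) i j) := by
      rw [frameMap_apply]
      exact congrArg _ (congrFun (ht.act_transMat (w t)) j).symm
    rw [h4, (ht.isInvertible_frameMap hb).inverse_apply_self]
  refine h2.congr_of_eventuallyEq ?_ (h3 t₀ h0 (FiberBundle.mem_baseSet_trivializationAt' _))
  filter_upwards [h0.eventually hσ hv, hσ.eventually (eventually_mem_baseSet (n := n) (σ t₀))] with t h5 h6
  exact h3 t h5 h6

theorem continuousWithinAt_act {v : ∀ t, Fin n → Tan n (σ t)}
    {A : Z → Matrix (Fin n) (Fin n) ℂ} (hσ : ContinuousWithinAt σ s t₀)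
    (hv : ∀ i, ContinuousWithinAt (fun t => (⟨σ t, v t i⟩ : TanBundle n X)) s t₀)
    (hA : ContinuousWithinAt A s t₀) (j : Fin n) :
    ContinuousWithinAt (fun t => (⟨σ t, act J (v t) (A t) j⟩ : TanBundle n X)) s t₀ :=
  continuousWithinAt_comb J hσ hv fun i =>
    continuousWithinAt_matrix_iff.1 hA i j

variable (J) in
/-- Local complex frames exist. -/
theorem exists_local_frame (x₀ : X) : ∃ (V : Set X) (u : ∀ y : X, Fin n → Tan n y),
    IsOpen V ∧ x₀ ∈ V ∧ (∀ y ∈ V, IsComplexFrame J y (u y)) ∧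
      ∀ i, ∀ y ∈ V, ContinuousAt (fun y => (⟨y, u y i⟩ : TanBundle n X)) y := by
  obtain ⟨v, hv⟩ := exists_isComplexFrame J x₀
  let e := trivializationAt (EuclideanSpace ℝ (Fin (2 * n))) (TangentSpace (𝓡 (2 * n))) x₀
  -- The frame at `x₀` is extended with constant coordinates. It need not be complex independent on
  -- the whole base set, so the neighborhood is shrunk afterwards.
  let u : ∀ y : X, Fin n → Tan n y := fun y i => e.symm y (e.continuousLinearMapAt ℝ x₀ (v i))
  have hx₀ : x₀ ∈ e.baseSet := FiberBundle.mem_baseSet_trivializationAt' x₀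
  have hu0 : u x₀ = v := by
    funext i
    have h := e.symmL_continuousLinearMapAt (R := ℝ) hx₀ (v i)
    rwa [Bundle.Trivialization.symmL_apply e hx₀] at h
  have hc : ∀ i, ContinuousOn (fun y => (⟨y, u y i⟩ : TanBundle n X)) e.baseSet := by
    intro i
    have h1 : ContinuousOn (fun y : X => (y, e.continuousLinearMapAt ℝ x₀ (v i))) e.baseSet :=
      (continuous_id.prodMk continuous_const).continuousOn
    have h2 := e.continuousOn_symm.comp h1 fun y hy => ⟨hy, Set.mem_univ _⟩
    exact h2
  have hc' : ∀ i, ∀ y ∈ e.baseSet, ContinuousAt (fun y => (⟨y, u y i⟩ : TanBundle n X)) y :=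
    fun i y hy => (hc i).continuousAt (e.open_baseSet.mem_nhds hy)
  have hev := IsComplexFrame.eventually (J := J) (σ := id) (s := Set.univ) (t₀ := x₀) (v := u)
    continuousWithinAt_id (fun i => (hc' i x₀ hx₀).continuousWithinAt) (by rw [id, hu0]; exact hv)
  rw [nhdsWithin_univ] at hev
  obtain ⟨V, hV, hVo, hxV⟩ := eventually_nhds_iff.1 (hev.and (e.open_baseSet.mem_nhds hx₀))
  exact ⟨V, u, hVo, hxV, fun y hy => (hV y hy).1, fun i y hy => hc' i y (hV y hy).2⟩

end Sections

/-! ### Lagrangian frames and their phases -/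

section Lagrangian

open Module

variable {n : ℕ} {X : Type u} [TopologicalSpace X]
  [ChartedSpace (EuclideanSpace ℝ (Fin (2 * n))) X] [IsManifold (𝓡 (2 * n)) ∞ X]
  {Ω : SymplecticForm n X} {x : X}

theorem IsLagrangian.form_eq_zero {P : Submodule ℝ (Tan n x)} (hP : IsLagrangian Ω P)
    {a b : Tan n x} (ha : a ∈ P) (hb : b ∈ P) : Ω.form x a b = 0 :=
  (hP a).1 ha b hb

/-- A Lagrangian subspace is totally real. -/
theorem IsLagrangian.eq_zero_of_add_J {P : Submodule ℝ (Tan n x)} (hP : IsLagrangian Ω P)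
    (J : CompatibleACS Ω) {a b : Tan n x} (ha : a ∈ P) (hb : b ∈ P) (h : a + J.J x b = 0) :
    a = 0 ∧ b = 0 := by
  have hb0 : b = 0 := by
    by_contra hne
    have h1 := J.positive x b hne
    rw [eq_neg_of_add_eq_zero_right h, map_neg, hP.form_eq_zero hb ha, neg_zero] at h1
    exact lt_irrefl _ h1
  subst hb0
  simpa using h

/-- The upper bound holds because `P` and `J P` meet only in zero, so `P × P` injects into the
tangent space. For the lower bound, `P` is the kernel of the map `a ↦ Ω(a, ·)` to the dual of `P`,
hence `2n ≤ 2 dim P`. -/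
theorem IsLagrangian.finrank_eq {P : Submodule ℝ (Tan n x)} (hP : IsLagrangian Ω P)
    (J : CompatibleACS Ω) : finrank ℝ P = n := by
  have h1 : finrank ℝ (P × P) ≤ 2 * n := by
    refine (LinearMap.finrank_le_finrank_of_injective
      (f := P.subtype.coprod ((J.J x).toLinearMap.comp P.subtype)) ?_).trans (finrank_tan x).le
    rw [← LinearMap.ker_eq_bot, LinearMap.ker_eq_bot']
    rintro ⟨a, b⟩ hab
    obtain ⟨h1, h2⟩ := hP.eq_zero_of_add_J J a.2 b.2 (by simpa using hab)
    exact Prod.ext (Subtype.ext h1) (Subtype.ext h2)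
  let φ : Tan n x →ₗ[ℝ] (P →ₗ[ℝ] ℝ) :=
    { toFun := fun a => (Ω.form x a).toLinearMap.comp P.subtype
      map_add' := fun a b => by ext c; simp
      map_smul' := fun r a => by ext c; simp }
  have hker : LinearMap.ker φ = P := by
    ext a
    rw [LinearMap.mem_ker, hP a]
    constructor
    · intro h b hb
      exact LinearMap.congr_fun h ⟨b, hb⟩
    · intro h
      ext b
      exact h b.1 b.2
  have h2 := LinearMap.finrank_range_add_finrank_ker φ
  have h3 : finrank ℝ (LinearMap.range φ) ≤ finrank ℝ P :=
    (Submodule.finrank_le _).trans (Subspace.dual_finrank_eq (K := ℝ) (V := P)).le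
  rw [hker, finrank_tan] at h2
  rw [finrank_prod] at h1
  omega

variable (J : CompatibleACS Ω)

theorem comb_ofReal (v : Fin n → Tan n x) (c : Fin n → ℝ) :
    comb J v (fun i => (c i : ℂ)) = ∑ i, c i • v i := by
  simp [comb]

theorem comb_eq (v : Fin n → Tan n x) (c : Fin n → ℂ) :
    comb J v c = (∑ i, (c i).re • v i) + J.J x (∑ i, (c i).im • v i) := by
  simp [comb, Finset.sum_add_distrib]

variable {J}

theorem IsLagrangian.isComplexFrame {v : Fin n → Tan n x}
    (hP : IsLagrangian Ω (Submodule.span ℝ (Set.range v))) (hv : LinearIndependent ℝ v) :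
    IsComplexFrame J x v := by
  have hmem : ∀ c : Fin n → ℝ, ∑ i, c i • v i ∈ Submodule.span ℝ (Set.range v) := fun c =>
    Submodule.sum_mem _ fun i _ => Submodule.smul_mem _ _ (Submodule.subset_span ⟨i, rfl⟩)
  rw [isComplexFrame_iff_injective, ← LinearMap.ker_eq_bot, LinearMap.ker_eq_bot']
  intro c hc
  rw [combL_apply, comb_eq] at hc
  obtain ⟨h1, h2⟩ := hP.eq_zero_of_add_J J (hmem _) (hmem _) hc
  funext i
  exact Complex.ext (Fintype.linearIndependent_iff.1 hv _ h1 i)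
    (Fintype.linearIndependent_iff.1 hv _ h2 i)

theorem IsLagrangian.exists_frame {P : Submodule ℝ (Tan n x)} (hP : IsLagrangian Ω P)
    (J : CompatibleACS Ω) :
    ∃ v : Fin n → Tan n x, LinearIndependent ℝ v ∧ Submodule.span ℝ (Set.range v) = P := by
  let b := finBasisOfFinrankEq ℝ P (hP.finrank_eq J)
  refine ⟨fun i => b i, b.linearIndependent.map' P.subtype P.ker_subtype, ?_⟩
  have h := congrArg (Submodule.map P.subtype) b.span_eq
  rw [Submodule.map_span, Submodule.map_top, Submodule.range_subtype, ← Set.range_comp] at h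
  exact h

variable (J) in
theorem exists_real_of_mem_span {v w : Fin n → Tan n x}
    (hw : ∀ j, w j ∈ Submodule.span ℝ (Set.range v)) :
    ∃ R : Matrix (Fin n) (Fin n) ℝ, w = act J v (R.map Complex.ofReal) := by
  choose c hc using fun j => (Submodule.mem_span_range_iff_exists_fun ℝ).1 (hw j)
  refine ⟨Matrix.of fun i j => c j i, funext fun j => ?_⟩
  rw [← hc j, ← comb_ofReal J]
  rfl

variable (J) in
theorem act_ofReal_mem {v : Fin n → Tan n x} {P : Submodule ℝ (Tan n x)} (hv : ∀ i, v i ∈ P)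
    (R : Matrix (Fin n) (Fin n) ℝ) (j : Fin n) : act J v (R.map Complex.ofReal) j ∈ P := by
  have : act J v (R.map Complex.ofReal) j = ∑ i, R i j • v i := comb_ofReal J v fun i => R i j
  rw [this]
  exact Submodule.sum_mem _ fun i _ => Submodule.smul_mem _ _ (hv i)

theorem det_map_ofReal (R : Matrix (Fin n) (Fin n) ℝ) :
    (R.map Complex.ofReal).det = (R.det : ℂ) :=
  (Complex.ofRealHom.map_det R).symm

/-- The entrywise complex conjugate of a matrix. -/
def conjMat : Matrix (Fin n) (Fin n) ℂ →+* Matrix (Fin n) (Fin n) ℂ :=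
  (starRingEnd ℂ).mapMatrix

theorem conjMat_apply (A : Matrix (Fin n) (Fin n) ℂ) (i j : Fin n) :
    conjMat A i j = starRingEnd ℂ (A i j) := rfl

theorem conjMat_map_ofReal (R : Matrix (Fin n) (Fin n) ℝ) :
    conjMat (R.map Complex.ofReal) = R.map Complex.ofReal := by
  ext i j
  simp [conjMat_apply]

theorem det_conjMat (A : Matrix (Fin n) (Fin n) ℂ) :
    (conjMat A).det = starRingEnd ℂ A.det :=
  ((starRingEnd ℂ).map_det A).symm

variable (J) in
/-- The matrix `A * conj(A)⁻¹`, where `A` expresses the real frame `v` through the complex frame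
`u`. It only depends on the real span of `v`. -/
def lagMat (u v : Fin n → Tan n x) : Matrix (Fin n) (Fin n) ℂ :=
  transMat J u v * (conjMat (transMat J u v))⁻¹

/-- Another real frame of the same plane changes `A` to `A R` with `R` real, and `R` cancels in `A R
(conj(A) R)⁻¹`. So `lagMat` descends to the Lagrangian Grassmannian, where tameness is formulated.
-/
theorem lagMat_eq_of_span_eq {u v w : Fin n → Tan n x} (hu : IsComplexFrame J x u)
    (hv : IsComplexFrame J x v) (hw : IsComplexFrame J x w)
    (h : ∀ j, w j ∈ Submodule.span ℝ (Set.range v)) : lagMat J u w = lagMat J u v := by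
  obtain ⟨R, rfl⟩ := exists_real_of_mem_span J h
  have h1 : transMat J u (act J v (R.map Complex.ofReal)) =
      transMat J u v * R.map Complex.ofReal := by
    rw [← hu.transMat_mul hv, hv.transMat_act]
  have h2 : IsUnit (R.map Complex.ofReal).det := (hv.act_iff.1 hw).isUnit
  rw [lagMat, h1, map_mul, conjMat_map_ofReal, Matrix.mul_inv_rev, Matrix.mul_assoc,
    Matrix.mul_nonsing_inv_cancel_left _ _ h2, lagMat]

/-- With `z` the determinant of the transition matrix, the determinant of `lagMat` is `z / conj z`,
whose phase is the square of the phase of `z`. -/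
theorem phase_det_lagMat {u v : Fin n → Tan n x} (hu : IsComplexFrame J x u)
    (hv : IsComplexFrame J x v) :
    (lagMat J u v).det ≠ 0 ∧ phase (lagMat J u v).det = phase (transMat J u v).det ^ 2 := by
  have hd := hu.det_transMat_ne_zero hv
  set z := (transMat J u v).det with hz
  have hc : starRingEnd ℂ z ≠ 0 := by simpa using hd
  have h1 : (lagMat J u v).det = z / starRingEnd ℂ z := by
    rw [lagMat, Matrix.det_mul, Matrix.det_nonsing_inv, det_conjMat, ← hz, Ring.inverse_eq_inv',
      div_eq_mul_inv]
  refine ⟨by rw [h1]; exact div_ne_zero hd hc, ?_⟩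
  have h2 : z * (lagMat J u v).det⁻¹ = starRingEnd ℂ z := by
    rw [h1]
    field_simp
  have h3 : z * starRingEnd ℂ z = ((Complex.normSq z : ℝ) : ℂ) := Complex.mul_conj z
  have h4 : phase z * phase (starRingEnd ℂ z) = 1 := by
    rw [← phase_mul hd hc, h3, phase_ofReal (Complex.normSq_pos.2 hd)]
  have h5 : (lagMat J u v).det * starRingEnd ℂ z = z := by
    rw [h1, div_mul_cancel₀ _ hc]
  have h6 : phase (lagMat J u v).det * phase (starRingEnd ℂ z) = phase z := by
    rw [← phase_mul (by rw [h1]; exact div_ne_zero hd hc) hc, h5]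
  rw [pow_two]
  calc phase (lagMat J u v).det
      = phase (lagMat J u v).det * (phase z * phase (starRingEnd ℂ z)) := by rw [h4, mul_one]
    _ = phase z * (phase (lagMat J u v).det * phase (starRingEnd ℂ z)) := by
        rw [mul_left_comm]
    _ = phase z * phase z := by rw [h6]

end Lagrangian

/-! ### Continuity of the tangent planes of a tame fibration -/

section Tame

variable {n : ℕ} {X : Type u} [TopologicalSpace X]
  [ChartedSpace (EuclideanSpace ℝ (Fin (2 * n))) X] [IsManifold (𝓡 (2 * n)) ∞ X]
  {Ω : SymplecticForm n X}

theorem LagFrame.continuous_prod :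
    Continuous (fun F : LagFrame Ω =>
      ((F.base, fun i => ⟨F.base, F.vec i⟩) : X × (Fin n → TanBundle n X))) :=
  continuous_induced_dom

theorem LagFrame.continuous_base : Continuous (LagFrame.base : LagFrame Ω → X) :=
  continuous_fst.comp LagFrame.continuous_prod

theorem LagFrame.continuous_vec (i : Fin n) :
    Continuous fun F : LagFrame Ω => (⟨F.base, F.vec i⟩ : TanBundle n X) :=
  (continuous_apply i).comp (continuous_snd.comp LagFrame.continuous_prod)

variable (J : CompatibleACS Ω)

include J in
theorem LagFrame.isQuotientMap_span :
    Topology.IsQuotientMap (LagFrame.span : LagFrame Ω → LagGrass Ω) := by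
  refine ⟨⟨rfl⟩, ?_⟩
  rintro ⟨x, P, hP⟩
  obtain ⟨v, hv, rfl⟩ := hP.exists_frame J
  exact ⟨⟨x, v, hv, hP⟩, rfl⟩

variable {J}

theorem continuousAt_matrix_inv {m : ℕ} {A : Matrix (Fin m) (Fin m) ℂ} (hA : A.det ≠ 0) :
    ContinuousAt (fun B : Matrix (Fin m) (Fin m) ℂ => B⁻¹) A := by
  simp only [Matrix.inv_def, Ring.inverse_eq_inv']
  have h1 : Continuous fun B : Matrix (Fin m) (Fin m) ℂ => B.det := continuous_id.matrix_det
  have h2 : Continuous fun B : Matrix (Fin m) (Fin m) ℂ => B.adjugate :=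
    continuous_id.matrix_adjugate
  exact (h1.continuousAt.inv₀ hA).smul h2.continuousAt

theorem continuous_conjMat {m : ℕ} :
    Continuous (conjMat : Matrix (Fin m) (Fin m) ℂ → Matrix (Fin m) (Fin m) ℂ) :=
  continuous_id.matrix_map Complex.continuous_conj

theorem continuousWithinAt_lagMat {Z : Type*} [TopologicalSpace Z] {σ : Z → X} {s : Set Z} {t₀ : Z}
    {v w : ∀ t, Fin n → Tan n (σ t)} (hσ : ContinuousWithinAt σ s t₀)
    (hv : ∀ i, ContinuousWithinAt (fun t => (⟨σ t, v t i⟩ : TanBundle n X)) s t₀)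
    (hw : ∀ i, ContinuousWithinAt (fun t => (⟨σ t, w t i⟩ : TanBundle n X)) s t₀)
    (h0 : IsComplexFrame J (σ t₀) (v t₀)) (h1 : IsComplexFrame J (σ t₀) (w t₀)) :
    ContinuousWithinAt (fun t => lagMat J (v t) (w t)) s t₀ := by
  have hA := continuousWithinAt_transMat hσ hv hw h0
  have hc : ContinuousWithinAt (fun t => conjMat (transMat J (v t) (w t))) s t₀ :=
    continuous_conjMat.continuousAt.comp_continuousWithinAt hA
  have hdet : (conjMat (transMat J (v t₀) (w t₀))).det ≠ 0 := by
    rw [det_conjMat]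
    simpa using h0.det_transMat_ne_zero h1
  have hinv : ContinuousWithinAt (fun t => (conjMat (transMat J (v t) (w t)))⁻¹) s t₀ :=
    Filter.Tendsto.comp (continuousAt_matrix_inv hdet) hc
  exact hA.mul hinv

variable {B : Type v}

/-- `v` is a real frame of the tangent space of the fiber of `f` at the point `x` of the smooth
locus. -/
def IsFiberFrame (Ω : SymplecticForm n X) (f : X → B) (x : X) (v : Fin n → Tan n x) : Prop :=
  x ∈ smoothLocus Ω f ∧ LinearIndependent ℝ v ∧
    Submodule.span ℝ (Set.range v) = tangentTo n (f ⁻¹' {f x}) x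

theorem IsFiberFrame.isComplexFrame {f : X → B} {x : X} {v : Fin n → Tan n x}
    (hv : IsFiberFrame Ω f x v) : IsComplexFrame J x v :=
  IsLagrangian.isComplexFrame (hv.2.2 ▸ isLagrangian_tangentTo_fiber Ω f hv.1) hv.2.1

theorem IsFiberFrame.mem {f : X → B} {x : X} {v : Fin n → Tan n x}
    (hv : IsFiberFrame Ω f x v) (i : Fin n) : v i ∈ tangentTo n (f ⁻¹' {f x}) x :=
  hv.2.2 ▸ Submodule.subset_span ⟨i, rfl⟩

include J in
theorem exists_isFiberFrame {f : X → B} {x : X} (hx : x ∈ smoothLocus Ω f) :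
    ∃ v, IsFiberFrame Ω f x v := by
  obtain ⟨v, hv, h⟩ := (isLagrangian_tangentTo_fiber Ω f hx).exists_frame J
  exact ⟨v, hx, hv, h⟩

/-- Complex independence implies real independence, and `n` independent vectors fill an
`n`-dimensional plane. -/
theorem isFiberFrame_of_mem {f : X → B} {x : X} (hx : x ∈ smoothLocus Ω f) {v : Fin n → Tan n x}
    (hv : IsComplexFrame J x v) (h : ∀ i, v i ∈ tangentTo n (f ⁻¹' {f x}) x) :
    IsFiberFrame Ω f x v := by
  have hli : LinearIndependent ℝ v := by
    have := hv.comp Sum.inl Sum.inl_injective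
    simpa using this
  refine ⟨hx, hli, Submodule.eq_of_le_of_finrank_eq (Submodule.span_le.2 ?_) ?_⟩
  · rintro _ ⟨i, rfl⟩
    exact h i
  · rw [finrank_span_eq_card hli, Fintype.card_fin,
      (isLagrangian_tangentTo_fiber Ω f hx).finrank_eq J]

/-- For a tame fibration, the matrices `lagMat` of the tangent planes of the fibers with respect to
a local complex frame are continuous on the smooth locus. -/
theorem IsTame.exists_continuousOn_lagMat {f : X → B} (hf : IsTame Ω f) {V : Set X} (hV : IsOpen V)
    {u : ∀ y : X, Fin n → Tan n y} (hu : ∀ y ∈ V, IsComplexFrame J y (u y))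
    (huc : ∀ i, ∀ y ∈ V, ContinuousAt (fun y => (⟨y, u y i⟩ : TanBundle n X)) y) :
    ∃ M : X → Matrix (Fin n) (Fin n) ℂ, ContinuousOn M (V ∩ smoothLocus Ω f) ∧
      ∀ y ∈ V, ∀ v, IsFiberFrame Ω f y v → M y = lagMat J (u y) v := by
  classical
  have hq := LagFrame.isQuotientMap_span J
  choose fr hfr using hq.surjective
  -- The chosen frames `fr` vary arbitrarily with the plane, but `lagMat` does not see the choice.
  -- Continuity of `β` can thus be tested on the bundle of frames, of which the Grassmannian is a
  -- quotient.
  let β : LagGrass Ω → Matrix (Fin n) (Fin n) ℂ := fun ℓ =>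
    lagMat J (u (fr ℓ).base) (fr ℓ).vec
  have hcf : ∀ F : LagFrame Ω, IsComplexFrame J F.base F.vec := fun F =>
    F.isLagrangian.isComplexFrame F.linearIndependent
  have hβ : ∀ F : LagFrame Ω, F.base ∈ V → β F.span = lagMat J (u F.base) F.vec := by
    intro F hF
    have h := hfr F.span
    change lagMat J (u (fr F.span).base) (fr F.span).vec = _
    generalize fr F.span = F' at h
    obtain ⟨x, w, hw1, hw2⟩ := F
    obtain ⟨x', w', hw1', hw2'⟩ := F'
    simp only [LagFrame.span, LagGrass.mk.injEq] at h
    obtain ⟨rfl, h⟩ := h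
    refine lagMat_eq_of_span_eq (hu _ hF) (hcf ⟨_, w, hw1, hw2⟩) (hcf ⟨_, w', hw1', hw2'⟩)
      fun j => ?_
    rw [← h]
    exact Submodule.subset_span ⟨j, rfl⟩
  have hbase : IsOpen {ℓ : LagGrass Ω | ℓ.base ∈ V} := by
    rw [← hq.isOpen_preimage]
    exact hV.preimage LagFrame.continuous_base
  have hβc : ContinuousOn β {ℓ : LagGrass Ω | ℓ.base ∈ V} := by
    rw [hq.continuousOn_isOpen_iff hbase]
    intro F hF
    have hb := LagFrame.continuous_base.continuousAt (x := F)
    have h1 := continuousWithinAt_lagMat (J := J) (σ := (LagFrame.base : LagFrame Ω → X))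
      (s := Set.univ) (t₀ := F) (v := fun F => u F.base) (w := fun F => F.vec)
      hb.continuousWithinAt
      (fun i => ((huc i F.base hF).comp hb).continuousWithinAt)
      (fun i => (LagFrame.continuous_vec i).continuousAt.continuousWithinAt) (hu _ hF) (hcf F)
    exact (h1.mono (Set.subset_univ _)).congr (fun F' hF' => hβ F' hF') (hβ F hF)
  refine ⟨fun y => if hy : y ∈ smoothLocus Ω f then β (tangentSection Ω f ⟨y, hy⟩) else 0, ?_, ?_⟩
  · intro y hy
    have h1 : ContinuousAt (fun p : smoothLocus Ω f => β (tangentSection Ω f p)) ⟨y, hy.2⟩ :=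
      ContinuousAt.comp (g := β) (f := tangentSection Ω f)
        (hβc.continuousAt (hbase.mem_nhds hy.1)) hf.continuousAt
    refine ContinuousWithinAt.mono ?_ Set.inter_subset_right
    rw [continuousWithinAt_iff_continuousAt_domRestrict _ hy.2]
    refine h1.congr (Filter.Eventually.of_forall fun p => ?_)
    simp [Set.domRestrict]
  · intro y hy v hv
    simp only [dif_pos hv.1]
    have h1 : tangentSection Ω f ⟨y, hv.1⟩ = LagFrame.span
        ⟨y, v, hv.2.1, hv.2.2 ▸ isLagrangian_tangentTo_fiber Ω f hv.1⟩ := by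
      simp only [tangentSection, LagFrame.span, LagGrass.mk.injEq, true_and]
      exact hv.2.2.symm
    rw [h1, hβ _ hy]

end Tame

/-! ### Splitting of real cocycles, and lifts of circle-valued cocycles -/

section Cocycles

open Filter

variable {ι X : Type*} [TopologicalSpace X]

/-- Continuous real Čech cocycles on paracompact spaces are coboundaries. -/
theorem exists_split_cocycle [NormalSpace X] [ParacompactSpace X] {V : ι → Set X}
    (hV : ∀ i, IsOpen (V i)) (hcov : ∀ x, ∃ i, x ∈ V i) {β : ι → ι → X → ℝ}
    (hβ : ∀ i j, ContinuousOn (β i j) (V i ∩ V j))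
    (hadd : ∀ i j k, ∀ x ∈ V i, x ∈ V j → x ∈ V k → β i k x = β i j x + β j k x) :
    ∃ η : ι → X → ℝ, (∀ i, ContinuousOn (η i) (V i)) ∧
      ∀ i j, ∀ x ∈ V i, x ∈ V j → β i j x = η i x - η j x := by
  obtain ⟨ρ, hρ⟩ := PartitionOfUnity.exists_isSubordinate isClosed_univ V hV
    fun x _ => Set.mem_iUnion.2 (hcov x)
  have hmem : ∀ x, ∀ k ∈ ρ.finsupport x, x ∈ V k := fun x k hk =>
    hρ k (subset_tsupport _ (ρ.mem_finsupport x |>.1 hk))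
  -- The usual splitting `η_i = ∑ ρ_k β_ik`. The support of `ρ k` lies in `V k`, so only values of
  -- `β i k` on `V i ∩ V k` matter.
  refine ⟨fun i x => ∑ k ∈ ρ.finsupport x, ρ k x * β i k x, fun i x hx => ?_, fun i j x hi hj => ?_⟩
  · have h1 : ∀ y, ρ.finsupport y ⊆ ρ.fintsupport x →
        ∑ k ∈ ρ.finsupport y, ρ k y * β i k y = ∑ k ∈ ρ.fintsupport x, ρ k y * β i k y := by
      intro y hy
      refine Finset.sum_subset hy fun k _ hk => ?_
      have : ρ k y = 0 := by
        by_contra h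
        exact hk ((ρ.mem_finsupport y).2 h)
      rw [this, zero_mul]
    have h2 : ContinuousAt (fun y => ∑ k ∈ ρ.fintsupport x, ρ k y * β i k y) x := by
      refine tendsto_finsetSum _ fun k hk => ?_
      have hxk : x ∈ V k := hρ k ((ρ.mem_fintsupport_iff x k).1 hk)
      exact (ρ k).continuous.continuousAt.mul ((hβ i k).continuousAt
        (((hV i).inter (hV k)).mem_nhds ⟨hx, hxk⟩))
    refine (h2.congr_of_eventuallyEq ?_).continuousWithinAt
    filter_upwards [ρ.eventually_finsupport_subset x] with y hy
    exact h1 y hy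
  · rw [← Finset.sum_sub_distrib]
    have : ∀ k ∈ ρ.finsupport x, ρ k x * β i k x - ρ k x * β j k x = ρ k x * β i j x := by
      intro k hk
      rw [hadd i j k x hi hj (hmem x k hk)]
      ring
    rw [Finset.sum_congr rfl this, ← Finset.sum_mul, ρ.sum_finsupport (Set.mem_univ x), one_mul]

/-- A continuous circle-valued cocycle `c` which on a dense subset `G` with locally connected
complement of codimension at least two is the coboundary of `exp ∘ θ` lifts to a real coboundary. -/
theorem exists_lift_cocycle [NormalSpace X] [ParacompactSpace X] {V : ι → Set X}
    (hV : ∀ i, IsOpen (V i)) (hcov : ∀ x, ∃ i, x ∈ V i) {G : Set X} (hG : Dense G)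
    (hloc : ∀ x : X, ∀ N ∈ 𝓝 x, ∃ W : Set X, IsOpen W ∧ x ∈ W ∧ W ⊆ N ∧ IsPreconnected (W ∩ G))
    {c : ι → ι → X → Circle} (hc : ∀ i j, ContinuousOn (c i j) (V i ∩ V j)) {θ : ι → X → ℝ}
    (hθ : ∀ i, ContinuousOn (θ i) (V i ∩ G))
    (hcθ : ∀ i j, ∀ x ∈ V i, x ∈ V j → x ∈ G → Circle.exp (θ i x - θ j x) = c i j x) :
    ∃ η : ι → X → ℝ, (∀ i, ContinuousOn (η i) (V i)) ∧
      (∀ i j, ∀ x ∈ V i, x ∈ V j → Circle.exp (η i x - η j x) = c i j x) ∧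
      ∀ i j, ∀ x ∈ V i, x ∈ V j → x ∈ G → η i x - η j x = θ i x - θ j x := by
  have hne : ∀ x, (𝓝[G] x).NeBot := fun x => mem_closure_iff_nhdsWithin_neBot.1 (hG x)
  -- On a small connected `W ∩ G`, both `θ i - θ j` and a shift of the principal argument `γ` of `c
  -- i j / c i j x` lift `c i j`, so they differ by a constant. The function `γ` is continuous at
  -- `x` even when `x` is not in `G`, which gives the limit.
  have hlim : ∀ i j, ∀ x ∈ V i ∩ V j, ∃ L, Tendsto (fun y => θ i y - θ j y) (𝓝[G] x) (𝓝 L) := by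
    intro i j x hx
    have hVx := ((hV i).inter (hV j)).mem_nhds hx
    have hcx : ContinuousAt (c i j) x := (hc i j).continuousAt hVx
    have hdiv : ContinuousAt (fun y => (c i j y / c i j x : ℂ)) x :=
      (continuous_subtype_val.continuousAt.comp hcx).div_const _
    have h1 : (c i j x / c i j x : ℂ) ∈ Complex.slitPlane := by
      rw [div_self (Circle.coe_ne_zero _)]
      exact Complex.one_mem_slitPlane
    have h2 := hdiv.eventually (Complex.isOpen_slitPlane.mem_nhds h1)
    obtain ⟨W, hWo, hxW, hWN, hWc⟩ := hloc x _ (inter_mem hVx h2)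
    set γ : X → ℝ := fun y => (c i j y / c i j x : ℂ).arg with hγ
    have hγc : ContinuousOn γ W := continuousOn_arg_div
      ((hc i j).mono fun y hy => (hWN hy).1) _ fun y hy => (hWN hy).2
    obtain ⟨c0, hc0⟩ := Circle.exp_surjective (c i j x)
    obtain ⟨y0, hy0W, hy0G⟩ := hG.inter_open_nonempty W hWo ⟨x, hxW⟩
    have hinc : ∀ y ∈ W ∩ G, θ i y - θ j y = γ y + (θ i y0 - θ j y0 - γ y0) := by
      intro y hy
      have h3 : ContinuousOn (fun y => θ i y - θ j y) (W ∩ G) :=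
        ((hθ i).mono fun y hy => ⟨(hWN hy.1).1.1, hy.2⟩).sub
          ((hθ j).mono fun y hy => ⟨(hWN hy.1).1.2, hy.2⟩)
      have h4 : ContinuousOn (fun y => γ y + c0) (W ∩ G) :=
        (hγc.mono Set.inter_subset_left).add continuousOn_const
      have h5 := sub_eq_sub_of_lift hWc h3 h4 (fun z hz => by
        rw [hcθ i j z (hWN hz.1).1.1 (hWN hz.1).1.2 hz.2, Circle.exp_add, hγ, exp_arg_div, hc0,
          div_mul_cancel]) ⟨hy0W, hy0G⟩ hy
      linarith
    refine ⟨γ x + (θ i y0 - θ j y0 - γ y0), ?_⟩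
    have h6 : Tendsto (fun y => γ y + (θ i y0 - θ j y0 - γ y0)) (𝓝[G] x)
        (𝓝 (γ x + (θ i y0 - θ j y0 - γ y0))) :=
      ((hγc.continuousAt (hWo.mem_nhds hxW)).continuousWithinAt).add tendsto_const_nhds
    refine h6.congr' ?_
    filter_upwards [inter_mem_nhdsWithin G (hWo.mem_nhds hxW)] with y hy
    exact (hinc y ⟨hy.2, hy.1⟩).symm
  let β : ι → ι → X → ℝ := fun i j => extendFrom G fun y => θ i y - θ j y
  have hβlim : ∀ i j, ∀ x ∈ V i, x ∈ V j →
      Tendsto (fun y => θ i y - θ j y) (𝓝[G] x) (𝓝 (β i j x)) := fun i j x hi hj =>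
    tendsto_extendFrom (hlim i j x ⟨hi, hj⟩)
  have hβc : ∀ i j, ContinuousOn (β i j) (V i ∩ V j) := fun i j =>
    continuousOn_extendFrom (fun x _ => hG x) (hlim i j)
  have hβG : ∀ i j, ∀ x ∈ V i, x ∈ V j → x ∈ G → β i j x = θ i x - θ j x := by
    intro i j x hi hj hx
    refine extendFrom_eq (hG x) ?_
    have h1 : ∀ k, x ∈ V k → Tendsto (θ k) (𝓝[G] x) (𝓝 (θ k x)) := fun k hk =>
      (hθ k x ⟨hk, hx⟩).mono_left (nhdsWithin_le_iff.2 (by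
        rw [Set.inter_comm]
        exact inter_mem_nhdsWithin G ((hV k).mem_nhds hk)))
    exact (h1 i hi).sub (h1 j hj)
  -- The cocycle identity is trivial for the differences of the `θ i` and passes to the limits from
  -- `G`.
  obtain ⟨η, hη, hsplit⟩ := exists_split_cocycle hV hcov hβc fun i j k x hi hj hk => by
    refine tendsto_nhds_unique (hβlim i k x hi hk) ?_
    refine ((hβlim i j x hi hj).add (hβlim j k x hj hk)).congr fun y => ?_
    ring
  refine ⟨η, hη, fun i j x hi hj => ?_, fun i j x hi hj hx => ?_⟩
  · rw [← hsplit i j x hi hj]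
    have hVx := ((hV i).inter (hV j)).mem_nhds (show x ∈ V i ∩ V j from ⟨hi, hj⟩)
    have h1 : Tendsto (fun y => Circle.exp (θ i y - θ j y)) (𝓝[G] x)
        (𝓝 (Circle.exp (β i j x))) :=
      (Circle.exp.continuous.tendsto _).comp (hβlim i j x hi hj)
    have h2 : Tendsto (c i j) (𝓝[G] x) (𝓝 (c i j x)) :=
      ((hc i j).continuousAt hVx).continuousWithinAt
    refine tendsto_nhds_unique h1 (h2.congr' ?_)
    filter_upwards [inter_mem_nhdsWithin G hVx] with y hy
    exact (hcθ i j y hy.2.1 hy.2.2 hy.1).symm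
  · rw [← hsplit i j x hi hj, hβG i j x hi hj hx]

end Cocycles

/-! ### The global section of the square of the determinant line bundle -/

section PhaseSection

variable {n : ℕ} {X : Type u} [TopologicalSpace X]
  [ChartedSpace (EuclideanSpace ℝ (Fin (2 * n))) X] [IsManifold (𝓡 (2 * n)) ∞ X]
  {Ω : SymplecticForm n X} (J : CompatibleACS Ω)

/-- A continuous nowhere vanishing section, up to positive factors, of the dual of the square of
the determinant line bundle of `(TX, J)`, as a function on complex frames. -/
structure PhaseSection where
  val : ∀ x : X, (Fin n → Tan n x) → Circle
  val_eq : ∀ (x : X) (v w : Fin n → Tan n x), IsComplexFrame J x v → IsComplexFrame J x w →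
    val x w = phase (transMat J v w).det ^ 2 * val x v
  continuous : ∀ (Z : Type) [TopologicalSpace Z] (σ : Z → X) (v : ∀ t, Fin n → Tan n (σ t)),
    Continuous σ → (∀ t, IsComplexFrame J (σ t) (v t)) →
    (∀ i, Continuous fun t => (⟨σ t, v t i⟩ : TanBundle n X)) → Continuous fun t => val (σ t) (v t)

theorem continuousWithinAt_phase_det {Z : Type*} [TopologicalSpace Z] {σ : Z → X} {s : Set Z}
    {t₀ : Z} {v w : ∀ t, Fin n → Tan n (σ t)} (hσ : ContinuousWithinAt σ s t₀)
    (hv : ∀ i, ContinuousWithinAt (fun t => (⟨σ t, v t i⟩ : TanBundle n X)) s t₀)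
    (hw : ∀ i, ContinuousWithinAt (fun t => (⟨σ t, w t i⟩ : TanBundle n X)) s t₀)
    (h0 : IsComplexFrame J (σ t₀) (v t₀)) (h1 : IsComplexFrame J (σ t₀) (w t₀)) :
    ContinuousWithinAt (fun t => phase (transMat J (v t) (w t)).det) s t₀ := by
  have hA := continuousWithinAt_transMat hσ hv hw h0
  have h2 : Continuous fun B : Matrix (Fin n) (Fin n) ℂ => B.det := continuous_id.matrix_det
  exact ContinuousAt.comp_continuousWithinAt (g := phase)
    (f := fun t => (transMat J (v t) (w t)).det)
    (continuousAt_phase (h0.det_transMat_ne_zero h1)) (h2.continuousAt.comp_continuousWithinAt hA)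

/-- The tangent planes of a tame Lagrangian fibration with singular locus of codimension at least
three determine a section of the square of the determinant line bundle over all of `X`, up to
homotopy on the smooth locus. -/
theorem exists_phaseSection [T2Space X] [SecondCountableTopology X] {B : Type v} {f : X → B}
    (htame : IsTame Ω f) (hcodim : HasCodimAtLeast n (smoothLocus Ω f)ᶜ 3) :
    ∃ (S : PhaseSection J) (ζ : X → ℝ), ContinuousOn ζ (smoothLocus Ω f) ∧
      ∀ x v, IsFiberFrame Ω f x v → S.val x v = Circle.exp (ζ x) := by
  set G := smoothLocus Ω f with hGdef
  have : LocallyCompactSpace X :=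
    ChartedSpace.locallyCompactSpace (EuclideanSpace ℝ (Fin (2 * n))) X
  have hdense : Dense G := by simpa using hcodim.dense_compl
  have hloc := fun (x : X) (N : Set X) (hN : N ∈ 𝓝 x) => hcodim.exists_nhds hN
  simp only [compl_compl] at hloc
  have hlocal : ∀ i : X, ∃ (V : Set X) (u : ∀ y : X, Fin n → Tan n y) (θ : X → ℝ), IsOpen V ∧
      i ∈ V ∧ (∀ y ∈ V, IsComplexFrame J y (u y)) ∧
      (∀ k, ∀ y ∈ V, ContinuousAt (fun y => (⟨y, u y k⟩ : TanBundle n X)) y) ∧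
      ContinuousOn θ (V ∩ G) ∧ ∀ y ∈ V, ∀ v, IsFiberFrame Ω f y v →
        Circle.exp (θ y) = phase (transMat J (u y) v).det ^ 2 := by
    intro i
    obtain ⟨V', u, hV', hiV', hu, huc⟩ := exists_local_frame J i
    obtain ⟨V, hVo, hiV, hVV', -, hlift⟩ := hloc i V' (hV'.mem_nhds hiV')
    obtain ⟨M, hM, hMv⟩ := htame.exists_continuousOn_lagMat hV' hu huc
    have hτ : ContinuousOn (fun y => phase (M y).det) (V ∩ G) := by
      intro y hy
      obtain ⟨v, hv⟩ := exists_isFiberFrame (J := J) hy.2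
      have h1 : (M y).det ≠ 0 := by
        rw [hMv y (hVV' hy.1) v hv]
        exact (phase_det_lagMat (hu y (hVV' hy.1)) hv.isComplexFrame).1
      have h2 : Continuous fun B : Matrix (Fin n) (Fin n) ℂ => B.det := continuous_id.matrix_det
      exact ContinuousAt.comp_continuousWithinAt (g := phase) (f := fun y => (M y).det)
        (continuousAt_phase h1) (h2.continuousAt.comp_continuousWithinAt
          ((hM y ⟨hVV' hy.1, hy.2⟩).mono (Set.inter_subset_inter_left _ hVV')))
    obtain ⟨θ, hθ, hθτ⟩ := hlift _ hτ
    refine ⟨V, u, θ, hVo, hiV, fun y hy => hu y (hVV' hy), fun k y hy => huc k y (hVV' hy), hθ,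
      fun y hy v hv => ?_⟩
    rw [hθτ y ⟨hy, hv.1⟩, hMv y (hVV' hy) v hv,
      (phase_det_lagMat (hu y (hVV' hy)) hv.isComplexFrame).2]
  choose V u θ hVo hiV hu huc hθ hθv using hlocal
  let c : X → X → X → Circle := fun i j y => phase (transMat J (u i y) (u j y)).det ^ 2
  have hmul : ∀ i j y, y ∈ V i → y ∈ V j → ∀ w, IsComplexFrame J y w →
      phase (transMat J (u i y) w).det ^ 2 = c i j y * phase (transMat J (u j y) w).det ^ 2 := by
    intro i j y hi hj w hw
    rw [← (hu i y hi).transMat_mul (hu j y hj), Matrix.det_mul, phase_mul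
      ((hu i y hi).det_transMat_ne_zero (hu j y hj)) ((hu j y hj).det_transMat_ne_zero hw),
      mul_pow]
  obtain ⟨η, hη, hηc, hηθ⟩ := exists_lift_cocycle (ι := X) hVo (fun x => ⟨x, hiV x⟩) hdense
    (fun x N hN => by
      obtain ⟨W, h1, h2, h3, h4, -⟩ := hloc x N hN
      exact ⟨W, h1, h2, h3, h4⟩) (c := c) (θ := θ)
    (fun i j y hy => by
      refine ContinuousWithinAt.pow ?_ 2
      exact continuousWithinAt_phase_det J (σ := id) continuousWithinAt_id
        (fun k => (huc i k y hy.1).continuousWithinAt)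
        (fun k => (huc j k y hy.2).continuousWithinAt) (hu i y hy.1) (hu j y hy.2)) hθ
    (fun i j y hi hj hy => by
      obtain ⟨v, hv⟩ := exists_isFiberFrame (J := J) hy
      rw [Circle.exp_sub, hθv i y hi v hv, hθv j y hj v hv, hmul i j y hi hj v hv.isComplexFrame,
        mul_div_cancel_right])
  -- The section below uses at each point `y` the chart indexed by `y` itself, which is not a
  -- locally constant choice. This identity replaces it by a fixed chart, where continuity is
  -- visible.
  have hind : ∀ i y, y ∈ V i → ∀ w, IsComplexFrame J y w →
      phase (transMat J (u y y) w).det ^ 2 * Circle.exp (-η y y) =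
        phase (transMat J (u i y) w).det ^ 2 * Circle.exp (-η i y) := by
    intro i y hi w hw
    rw [hmul i y y hi (hiV y) w hw, ← hηc i y y hi (hiV y), mul_right_comm,
      ← Circle.exp_add, mul_comm]
    congr 2
    ring
  refine ⟨⟨fun x w => phase (transMat J (u x x) w).det ^ 2 * Circle.exp (-η x x), ?_, ?_⟩,
    fun x => θ x x - η x x, ?_, ?_⟩
  · intro x v w hv hw
    rw [← (hu x x (hiV x)).transMat_mul hv, Matrix.det_mul, phase_mul
      ((hu x x (hiV x)).det_transMat_ne_zero hv) (hv.det_transMat_ne_zero hw), mul_pow]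
    rw [mul_comm (_ ^ 2) (_ ^ 2), mul_assoc]
  · intro Z _ σ v hσ hv hvc
    rw [continuous_iff_continuousAt]
    intro t₀
    have hV0 : ∀ᶠ t in 𝓝 t₀, σ t ∈ V (σ t₀) :=
      hσ.continuousAt.eventually ((hVo (σ t₀)).mem_nhds (hiV (σ t₀)))
    have h1 : ContinuousAt (fun t => phase (transMat J (u (σ t₀) (σ t)) (v t)).det ^ 2 *
        Circle.exp (-η (σ t₀) (σ t))) t₀ := by
      have h2 : ContinuousAt (fun t => η (σ t₀) (σ t)) t₀ :=
        ContinuousAt.comp (g := η (σ t₀)) (f := σ)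
          ((hη (σ t₀)).continuousAt ((hVo (σ t₀)).mem_nhds (hiV (σ t₀)))) hσ.continuousAt
      have h3 : ContinuousAt (fun t => phase (transMat J (u (σ t₀) (σ t)) (v t)).det) t₀ := by
        rw [← continuousWithinAt_univ]
        exact continuousWithinAt_phase_det J hσ.continuousWithinAt
          (fun k => (ContinuousAt.comp (f := σ) (huc (σ t₀) k (σ t₀) (hiV (σ t₀)))
            hσ.continuousAt).continuousWithinAt)
          (fun k => (hvc k).continuousWithinAt) (hu (σ t₀) (σ t₀) (hiV (σ t₀))) (hv t₀)
      exact (h3.pow 2).mul (Circle.exp.continuous.continuousAt.comp h2.neg)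
    refine h1.congr ?_
    filter_upwards [hV0] with t ht
    exact (hind (σ t₀) (σ t) ht (v t) (hv t)).symm
  · intro y hy
    have h1 : ContinuousWithinAt (fun x => θ y x - η y x) G y := by
      refine ContinuousWithinAt.sub ?_
        ((hη y).continuousAt ((hVo y).mem_nhds (hiV y))).continuousWithinAt
      refine (hθ y y ⟨hiV y, hy⟩).mono_of_mem_nhdsWithin ?_
      rw [Set.inter_comm]
      exact inter_mem_nhdsWithin G ((hVo y).mem_nhds (hiV y))
    refine h1.congr_of_eventuallyEq ?_ rfl
    filter_upwards [inter_mem_nhdsWithin G ((hVo y).mem_nhds (hiV y))] with x hx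
    -- On the smooth locus `η` and `θ` have the same differences between charts, so `θ i - η i` does
    -- not depend on `i`.
    have := hηθ y x x hx.2 (hiV x) hx.1
    linarith
  · intro x v hv
    change phase (transMat J (u x x) v).det ^ 2 * Circle.exp (-η x x) = _
    rw [← hθv x x (hiV x) v hv, ← Circle.exp_add, ← sub_eq_add_neg]

end PhaseSection

/-! ### Winding numbers of framings are coboundaries -/

section Winding

variable {n : ℕ} {X : Type u} [TopologicalSpace X]
  [ChartedSpace (EuclideanSpace ℝ (Fin (2 * n))) X] [IsManifold (𝓡 (2 * n)) ∞ X]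
  {Ω : SymplecticForm n X} {J : CompatibleACS Ω}

instance (k : ℕ) : PreconnectedSpace (stdSimplex ℝ (Fin (k + 1))) :=
  isPreconnected_iff_preconnectedSpace.1 (convex_stdSimplex ℝ (Fin (k + 1))).isPreconnected

theorem exists_lift_simplex {k : ℕ} {τ : stdSimplex ℝ (Fin (k + 1)) → Circle}
    (hτ : Continuous τ) :
    ∃ θ : stdSimplex ℝ (Fin (k + 1)) → ℝ, Continuous θ ∧ ∀ t, Circle.exp (θ t) = τ t :=
  exists_lift_of_convex (convex_stdSimplex ℝ (Fin (k + 1))) τ hτ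

theorem PhaseSection.continuous_along (S : PhaseSection J) {k : ℕ} {σ : Simplex X k}
    (F : FrameAlong J σ) : Continuous fun t => S.val (σ t) (F.vec t) :=
  S.continuous _ σ F.vec σ.continuous F.isFrame F.continuous

/-- Since `S` on `G` is the squared determinant phase times `S` on `F`, the relative rotation splits
into a contribution of `G` alone minus one of `F` alone. -/
theorem IsRotation.eq_sub (S : PhaseSection J) {e : Simplex X 1} {F G : FrameAlong J e} {r : ℝ}
    (hr : IsRotation 2 F G r) {a b : stdSimplex ℝ (Fin 2) → ℝ} (ha : Continuous a)
    (hb : Continuous b) (haF : ∀ t, Circle.exp (a t) = S.val (e t) (F.vec t))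
    (hbG : ∀ t, Circle.exp (b t) = S.val (e t) (G.vec t)) :
    2 * Real.pi * r = (b (stdSimplex.vertex 1) - b (stdSimplex.vertex 0)) -
      (a (stdSimplex.vertex 1) - a (stdSimplex.vertex 0)) := by
  obtain ⟨A, θ, hA, hθ, hAθ, hr⟩ := hr
  have h := sub_eq_sub_of_lift (isPreconnected_univ (α := stdSimplex ℝ (Fin (1 + 1))))
    (θ' := fun t => θ t + a t) hb.continuousOn (hθ.add ha).continuousOn (fun t _ => by
      have h1 := (F.isFrame t).transMat_eq (hA t)
      have h2 := (F.isFrame t).det_transMat_ne_zero (G.isFrame t)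
      rw [h1] at h2
      rw [hbG, S.val_eq _ _ _ (F.isFrame t) (G.isFrame t), h1, ← haF, Circle.exp_add,
        ← phase_pow h2, (eq_norm_mul_exp_iff (pow_ne_zero 2 h2) _).1 (hAθ t)])
    (Set.mem_univ (stdSimplex.vertex (0 : Fin 2))) (Set.mem_univ (stdSimplex.vertex (1 : Fin 2)))
  rw [hr, h]
  ring

theorem face_vertex {k : ℕ} (σ : Simplex X (k + 1)) (i : Fin (k + 2)) (j : Fin (k + 1)) :
    face σ i (stdSimplex.vertex j) = σ (stdSimplex.vertex (i.succAbove j)) :=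
  congrArg σ (stdSimplex.map_vertex _ _)

theorem faceMap_vertex {k : ℕ} (i : Fin (k + 2)) (j : Fin (k + 1)) :
    faceMap i (stdSimplex.vertex j) = stdSimplex.vertex (i.succAbove j) :=
  stdSimplex.map_vertex _ _

/-- The matching factor is positive, so it has phase one and `S` cannot distinguish the two frames.
-/
theorem Framing.val_edgeFrame_vertex (S : PhaseSection J) (Φ : Framing J 2) (e : Simplex X 1)
    (j : Fin 2) :
    S.val (e (stdSimplex.vertex j)) ((Φ.edgeFrame e).vec (stdSimplex.vertex j)) =
      S.val (e (stdSimplex.vertex j)) (Φ.vertexFrame (e (stdSimplex.vertex j))) := by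
  obtain ⟨A, hA, r, hr, hAr⟩ := Φ.matching e j
  have h1 := (Φ.vertexFrame_isFrame (e (stdSimplex.vertex j))).transMat_eq hA
  have h2 := (Φ.vertexFrame_isFrame (e (stdSimplex.vertex j))).det_transMat_ne_zero
    ((Φ.edgeFrame e).isFrame (stdSimplex.vertex j))
  rw [S.val_eq _ _ _ (Φ.vertexFrame_isFrame _) ((Φ.edgeFrame e).isFrame _), ← phase_pow h2, h1,
    hAr, phase_ofReal hr, one_mul]

/-- The winding numbers of a framing of the square of the determinant line bundle are the
coboundary of an integral cochain, if this bundle has a section. The cochain vanishes on the edges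
along which a logarithm of the section with respect to the framing is given. -/
theorem Framing.exists_eq_coboundary (S : PhaseSection J) (ζ : X → ℝ) (Φ : Framing J 2) :
    ∃ h : Cochain X 1,
      (∀ σ k, Φ.IsWinding σ k → k = h (face σ 0) - h (face σ 1) + h (face σ 2)) ∧
      ∀ e : Simplex X 1, (Continuous fun t => ζ (e t)) →
        (∀ t, S.val (e t) ((Φ.edgeFrame e).vec t) = Circle.exp (ζ (e t))) → h e = 0 := by
  classical
  have hpi : (2 * Real.pi) ≠ 0 := Real.two_pi_pos.ne'
  -- An argument `a x` of `S` is fixed at every vertex. The choice `ζ x` is imposed whenever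
  -- admissible, which makes the cochain vanish on the edges described by `ζ`.
  have hex : ∀ x, ∃ a : ℝ, Circle.exp a = S.val x (Φ.vertexFrame x) ∧
      (S.val x (Φ.vertexFrame x) = Circle.exp (ζ x) → a = ζ x) := by
    intro x
    by_cases h : S.val x (Φ.vertexFrame x) = Circle.exp (ζ x)
    · exact ⟨ζ x, h.symm, fun _ => rfl⟩
    · obtain ⟨a, ha⟩ := Circle.exp_surjective (S.val x (Φ.vertexFrame x))
      exact ⟨a, ha, fun h' => absurd h' h⟩
  choose a ha haζ using hex
  choose l hl hle using fun e : Simplex X 1 =>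
    exists_lift_simplex (S.continuous_along (Φ.edgeFrame e))
  choose m hm using fun (e : Simplex X 1) (j : Fin 2) =>
    exists_int_of_exp_eq ((hle e (stdSimplex.vertex j)).trans
      ((Φ.val_edgeFrame_vertex S e j).trans (ha _).symm))
  -- Up to the factor `2π`, this integer is the change of the argument `l e` along `e` minus the
  -- difference of the vertex values `a`. Around a triangle the values `a` and the lift `p` along
  -- the trivialization both telescope away, leaving the winding number.
  refine ⟨fun e => m e 1 - m e 0, fun σ k hk => ?_, fun e hζ he => ?_⟩
  · obtain ⟨F, r, hr, hkr⟩ := hk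
    obtain ⟨p, hp, hpF⟩ := exists_lift_simplex (S.continuous_along F)
    have hrot := fun i => (hr i).eq_sub S (a := fun t => p (faceMap i t)) (b := l (face σ i))
      (hp.comp (faceMap i).continuous) (hl _) (fun t => hpF (faceMap i t)) (hle _)
    have hm' : ∀ (i : Fin 3) (j : Fin 2), l (face σ i) (stdSimplex.vertex j) =
        a (σ (stdSimplex.vertex (i.succAbove j))) + m (face σ i) j * (2 * Real.pi) := by
      intro i j
      have := hm (face σ i) j
      rw [face_vertex] at this
      linarith
    have e0 := hrot 0
    have e1 := hrot 1
    have e2 := hrot 2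
    simp only [faceMap_vertex, hm'] at e0 e1 e2
    simp only [show (0 : Fin 3).succAbove (0 : Fin 2) = 1 by decide,
      show (0 : Fin 3).succAbove (1 : Fin 2) = 2 by decide,
      show (1 : Fin 3).succAbove (0 : Fin 2) = 0 by decide,
      show (1 : Fin 3).succAbove (1 : Fin 2) = 2 by decide,
      show (2 : Fin 3).succAbove (0 : Fin 2) = 0 by decide,
      show (2 : Fin 3).succAbove (1 : Fin 2) = 1 by decide] at e0 e1 e2
    have hfin : 2 * Real.pi * (k : ℝ) = 2 * Real.pi *
        (((m (face σ 0) 1 - m (face σ 0) 0) - (m (face σ 1) 1 - m (face σ 1) 0) +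
          (m (face σ 2) 1 - m (face σ 2) 0) : ℤ) : ℝ) := by
      rw [hkr]
      push_cast
      linarith
    exact_mod_cast mul_left_cancel₀ hpi hfin
  · have hav : ∀ j : Fin 2, a (e (stdSimplex.vertex j)) = ζ (e (stdSimplex.vertex j)) := fun j =>
      haζ _ ((Φ.val_edgeFrame_vertex S e j).symm.trans (he _))
    have h := sub_eq_sub_of_lift (isPreconnected_univ (α := stdSimplex ℝ (Fin (1 + 1))))
      (hl e).continuousOn hζ.continuousOn (fun t _ => (hle e t).trans (he t))
      (Set.mem_univ (stdSimplex.vertex (0 : Fin 2))) (Set.mem_univ (stdSimplex.vertex (1 : Fin 2)))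
    have h0 := hm e 0
    have h1 := hm e 1
    rw [hav] at h0 h1
    have h2 : ((m e 1 - m e 0 : ℤ) : ℝ) * (2 * Real.pi) = 0 := by
      push_cast
      linarith
    exact_mod_cast (mul_eq_zero.1 h2).resolve_right hpi

/-- The square of a framing. -/
def Framing.sq (Φ : Framing J 1) : Framing J 2 where
  vertexFrame := Φ.vertexFrame
  vertexFrame_isFrame := Φ.vertexFrame_isFrame
  edgeFrame := Φ.edgeFrame
  matching e j := by
    obtain ⟨A, hA, r, hr, h⟩ := Φ.matching e j
    refine ⟨A, hA, r ^ 2, by positivity, ?_⟩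
    rw [pow_one] at h
    rw [h]
    push_cast
    rfl

theorem IsRotation.sq {e : Simplex X 1} {F G : FrameAlong J e} {r : ℝ} (h : IsRotation 1 F G r) :
    IsRotation 2 F G (2 * r) := by
  obtain ⟨A, θ, hA, hθ, hAθ, hr⟩ := h
  refine ⟨A, fun t => 2 * θ t, hA, hθ.const_mul 2, fun t => ?_, by rw [← mul_sub, ← hr]; ring⟩
  have h1 := hAθ t
  rw [pow_one] at h1
  conv_lhs => rw [h1]
  rw [mul_pow, ← Complex.exp_nat_mul, norm_pow]
  push_cast
  congr 2
  ring

theorem Framing.IsWinding.sq {Φ : Framing J 1} {σ : Simplex X 2} {k : ℤ} (h : Φ.IsWinding σ k) :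
    Φ.sq.IsWinding σ (2 * k) := by
  obtain ⟨F, r, hr, hk⟩ := h
  refine ⟨F, fun i => 2 * r i, fun i => (hr i).sq, ?_⟩
  push_cast
  rw [hk]
  ring

end Winding

/-! ### The coboundary squares to zero; pairing with chains -/

section Chains

variable {X : Type u} [TopologicalSpace X]

theorem face_face_eq {k : ℕ} (σ : Simplex X (k + 2)) {i i' : Fin (k + 3)} {j j' : Fin (k + 2)}
    (h : ∀ l, i.succAbove (j.succAbove l) = i'.succAbove (j'.succAbove l)) :
    face (face σ i) j = face (face σ i') j' := by
  ext t
  refine congrArg σ ?_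
  have h1 : ∀ (a : Fin (k + 3)) (b : Fin (k + 2)), faceMap a (faceMap b t) =
      stdSimplex.map (fun l => a.succAbove (b.succAbove l)) t := fun a b =>
    stdSimplex.map_comp_apply _ _ _
  change faceMap i (faceMap j t) = faceMap i' (faceMap j' t)
  rw [h1, h1, funext h]

theorem coboundary_coboundary (h : Cochain X 1) : coboundary X 2 (coboundary X 1 h) = 0 := by
  funext σ
  have h01 : face (face σ 1) 0 = face (face σ 0) 0 := face_face_eq σ (by decide)
  have h02 : face (face σ 2) 0 = face (face σ 0) 1 := face_face_eq σ (by decide)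
  have h03 : face (face σ 3) 0 = face (face σ 0) 2 := face_face_eq σ (by decide)
  have h12 : face (face σ 2) 1 = face (face σ 1) 1 := face_face_eq σ (by decide)
  have h13 : face (face σ 3) 1 = face (face σ 1) 2 := face_face_eq σ (by decide)
  have h23 : face (face σ 3) 2 = face (face σ 2) 2 := face_face_eq σ (by decide)
  simp only [coboundary, AddMonoidHom.coe_mk, ZeroHom.coe_mk, Fin.sum_univ_succ, Fin.sum_univ_zero,
    Fin.succ_zero_eq_one, Fin.succ_one_eq_two, Pi.zero_apply, Fin.val_zero, Fin.val_succ]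
  rw [h01, h02, show (Fin.succ 2 : Fin 4) = 3 from rfl, h03, h12, h13, h23]
  ring

theorem coboundary_one_apply (h : Cochain X 1) (σ : Simplex X 2) :
    coboundary X 1 h σ = h (face σ 0) - h (face σ 1) + h (face σ 2) := by
  simp [coboundary, Fin.sum_univ_three]
  ring

/-- By Stokes the pairing is `h` evaluated on the boundary of `z`. That boundary is supported in
`L`, where `h` vanishes. -/
theorem sum_mul_coboundary_eq_zero {L : Set X} {h : Cochain X 1}
    (hL : ∀ e : Simplex X 1, Set.range e ⊆ L → h e = 0) (z : relCycles2 L) {k : Simplex X 2 → ℤ}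
    (hk : ∀ σ, k σ = h (face σ 0) - h (face σ 1) + h (face σ 2)) :
    (z.1.sum fun σ a => a * k σ) = 0 := by
  have h1 : Finsupp.linearCombination ℤ k =
      (Finsupp.linearCombination ℤ h).comp (boundary X 1) := by
    ext σ
    simp [boundary, Fin.sum_univ_three, hk]
    ring
  have h2 : (z.1.sum fun σ a => a * k σ) = Finsupp.linearCombination ℤ k z.1 := by
    simp [Finsupp.linearCombination_apply]
  rw [h2, h1, LinearMap.comp_apply, Finsupp.linearCombination_apply]
  refine Finset.sum_eq_zero fun e he => ?_
  have h3 : e ∈ {e : Simplex X 1 | Set.range e ⊆ L} :=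
    (Finsupp.mem_supported ℤ _).1 (show boundary X 1 z.1 ∈ chainsIn L 1 from z.2) he
  simp only [hL e h3, smul_zero]

end Chains

/-! ### Existence of frames along simplices -/

section Gluing

variable {n : ℕ} {X : Type u} [TopologicalSpace X]
  [ChartedSpace (EuclideanSpace ℝ (Fin (2 * n))) X] [IsManifold (𝓡 (2 * n)) ∞ X]
  {Ω : SymplecticForm n X} (J : CompatibleACS Ω)

/-- A class of complex frames which is stable under the transition matrices of its members. -/
structure FrameClass where
  mem : ∀ x : X, (Fin n → Tan n x) → Prop
  isFrame : ∀ {x : X} {v : Fin n → Tan n x}, mem x v → IsComplexFrame J x v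
  act_mem : ∀ {x y : X} {v w : Fin n → Tan n x} {g : Fin n → Tan n y}, mem x v → mem x w →
    mem y g → mem y (act J g (transMat J v w))

variable {J} {Z : Type*} [TopologicalSpace Z]

/-- There is a continuous frame of the class `P` along the restriction of `σ` to `K`. -/
def FrameClass.HasFrames (P : FrameClass J) (σ : Z → X) (K : Set Z) : Prop :=
  ∃ vec : ∀ t, Fin n → Tan n (σ t),
    (∀ i, ContinuousOn (fun t => (⟨σ t, vec t i⟩ : TanBundle n X)) K) ∧
    ∀ t ∈ K, P.mem (σ t) (vec t)

theorem FrameClass.HasFrames.mono {P : FrameClass J} {σ : Z → X} {K K' : Set Z}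
    (h : P.HasFrames σ K) (hK : K' ⊆ K) : P.HasFrames σ K' := by
  obtain ⟨vec, h1, h2⟩ := h
  exact ⟨vec, fun i => (h1 i).mono hK, fun t ht => h2 t (hK ht)⟩

theorem FrameClass.HasFrames.comp {P : FrameClass J} {σ : Z → X} {K : Set Z}
    (h : P.HasFrames σ K) {Z' : Type*} [TopologicalSpace Z'] {g : Z' → Z} (hg : Continuous g) :
    P.HasFrames (σ ∘ g) (g ⁻¹' K) := by
  obtain ⟨vec, h1, h2⟩ := h
  exact ⟨fun t => vec (g t), fun i => (h1 i).comp hg.continuousOn fun t ht => ht,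
    fun t ht => h2 (g t) ht⟩

/-- Frames over two closed sets can be glued if one set retracts to the intersection. -/
theorem FrameClass.HasFrames.union {P : FrameClass J} {σ : Z → X} (hσ : Continuous σ)
    {K₁ K₂ : Set Z} (h₁ : P.HasFrames σ K₁) (h₂ : P.HasFrames σ K₂) (hK₁ : IsClosed K₁)
    (hK₂ : IsClosed K₂) {r : Z → Z} (hr : ContinuousOn r K₂) (hr1 : Set.MapsTo r K₂ (K₁ ∩ K₂))
    (hr2 : ∀ t ∈ K₁ ∩ K₂, r t = t) : P.HasFrames σ (K₁ ∪ K₂) := by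
  classical
  obtain ⟨F, hF, hFP⟩ := h₁
  obtain ⟨G, hG, hGP⟩ := h₂
  -- The frame `G` is corrected by the transition matrix to `F`, which makes sense only on `K₁ ∩ K₂`
  -- and is extended over `K₂` through the retraction. The matrix is used over a different point
  -- from where it arises, which is what `act_mem` permits.
  let H : ∀ t, Fin n → Tan n (σ t) := fun t => act J (G t) (transMat J (G (r t)) (F (r t)))
  let v : ∀ t, Fin n → Tan n (σ t) := fun t => if t ∈ K₁ then F t else H t
  have hv1 : ∀ t ∈ K₁, v t = F t := fun t ht => if_pos ht
  have hv2 : ∀ t ∈ K₂, v t = H t := by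
    intro t ht
    by_cases h : t ∈ K₁
    · rw [hv1 t h]
      have : H t = act J (G t) (transMat J (G t) (F t)) := by
        simp only [H]
        rw [hr2 t ⟨h, ht⟩]
      rw [this, (P.isFrame (hGP t ht)).act_transMat]
    · exact if_neg h
  have hA : ContinuousOn (fun s => transMat J (G s) (F s)) (K₁ ∩ K₂) := fun s hs =>
    continuousWithinAt_transMat hσ.continuousWithinAt
      (fun i => (hG i s hs.2).mono Set.inter_subset_right)
      (fun i => (hF i s hs.1).mono Set.inter_subset_left) (P.isFrame (hGP s hs.2))
  have hH : ∀ i, ContinuousOn (fun t => (⟨σ t, H t i⟩ : TanBundle n X)) K₂ := fun i t ht =>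
    continuousWithinAt_act hσ.continuousWithinAt (fun i => hG i t ht)
      ((hA.comp hr hr1) t ht) i
  refine ⟨v, fun i => ?_, ?_⟩
  · refine ContinuousOn.union_of_isClosed ((hF i).congr fun t ht => ?_)
      ((hH i).congr fun t ht => ?_) hK₁ hK₂
    · simp only [hv1 t ht]
    · simp only [hv2 t ht]
  · rintro t (ht | ht)
    · rw [hv1 t ht]
      exact hFP t ht
    · rw [hv2 t ht]
      have := hr1 ht
      exact P.act_mem (hGP _ this.2) (hFP _ this.1) (hGP t ht)

/-- A Lebesgue number gives a subdivision into equal pieces on which `P` holds, and the pieces are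
glued from the left. -/
theorem interval_induction {P : ℝ → ℝ → Prop}
    (glue : ∀ a b c, a ≤ b → b ≤ c → P a b → P b c → P a c)
    (loc : ∀ x ∈ Set.Icc (0 : ℝ) 1, ∃ ε > 0, ∀ a b, x - ε < a → a ≤ b → b < x + ε → P a b) :
    P 0 1 := by
  choose! ε hε hP using loc
  obtain ⟨δ, hδ, h⟩ := lebesgue_number_lemma_of_metric (isCompact_Icc (a := (0 : ℝ)) (b := 1))
    (c := fun x : Set.Icc (0 : ℝ) 1 => Metric.ball (x : ℝ) (ε x)) (fun _ => Metric.isOpen_ball)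
    fun x hx => Set.mem_iUnion.2 ⟨⟨x, hx⟩, Metric.mem_ball_self (hε x hx)⟩
  have hloc : ∀ a b, a ∈ Set.Icc (0 : ℝ) 1 → a ≤ b → b < a + δ → P a b := by
    intro a b ha hab hb
    obtain ⟨x, hx⟩ := h a ha
    have h1 := hx (Metric.mem_ball_self hδ)
    have h2 := hx (show b ∈ Metric.ball a δ by
      rw [Metric.mem_ball, Real.dist_eq, abs_of_nonneg (by linarith)]
      linarith)
    rw [Metric.mem_ball, Real.dist_eq, abs_lt] at h1 h2
    exact hP x x.2 a b (by linarith) hab (by linarith)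
  obtain ⟨N, hN⟩ := exists_nat_gt (1 / δ)
  have hN0 : (0 : ℝ) < N := lt_trans (by positivity) hN
  have hNδ : 1 / (N : ℝ) < δ := by
    rw [div_lt_comm₀ hN0 hδ]
    exact hN
  have key : ∀ k : ℕ, k ≤ N → P 0 (k / N) := by
    intro k
    induction k with
    | zero =>
      intro _
      exact hloc _ _ (by simp) (by simp) (by simpa using hδ)
    | succ k ih =>
      intro hk
      have hk' : (k : ℝ) + 1 ≤ N := by exact_mod_cast hk
      have h0 : (0 : ℝ) ≤ k / N := by positivity
      have h1 : ((k + 1 : ℕ) : ℝ) / N = k / N + 1 / N := by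
        push_cast
        ring
      have h2 : (0 : ℝ) < 1 / N := by positivity
      refine glue 0 (k / N) _ h0 (by linarith) (ih (by omega)) (hloc _ _ ⟨h0, ?_⟩ (by linarith)
        (by linarith))
      rw [div_le_one hN0]
      linarith
  have := key N le_rfl
  rwa [div_self hN0.ne'] at this

/-- Small rectangles are glued horizontally to a thin strip around each height, and strips are then
stacked. Each gluing retracts a rectangle to its common side with the other. The height of a strip
shrinks to a minimum at each of finitely many gluings. -/
theorem FrameClass.hasFrames_square {P : FrameClass J} {σ : ℝ × ℝ → X} (hσ : Continuous σ)
    (hloc : ∀ z, ∃ N ∈ 𝓝 z, P.HasFrames σ N) :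
    P.HasFrames σ (Set.Icc 0 1 ×ˢ Set.Icc 0 1) := by
  have hrow : ∀ y : ℝ, ∃ ε > 0, P.HasFrames σ (Set.Icc 0 1 ×ˢ Set.Icc (y - ε) (y + ε)) := by
    intro y
    refine interval_induction (P := fun a b => ∃ ε > 0, P.HasFrames σ
      (Set.Icc a b ×ˢ Set.Icc (y - ε) (y + ε))) ?_ ?_
    · rintro a b c hab hbc ⟨ε₁, hε₁, h₁⟩ ⟨ε₂, hε₂, h₂⟩
      refine ⟨min ε₁ ε₂, lt_min hε₁ hε₂, ?_⟩
      have hI : ∀ ε, min ε₁ ε₂ ≤ ε → Set.Icc (y - min ε₁ ε₂) (y + min ε₁ ε₂) ⊆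
          Set.Icc (y - ε) (y + ε) := fun ε hε =>
        Set.Icc_subset_Icc (by linarith) (by linarith)
      rw [← Set.Icc_union_Icc_eq_Icc hab hbc, Set.union_prod]
      refine FrameClass.HasFrames.union hσ
        (h₁.mono (Set.prod_mono_right (hI _ (min_le_left _ _))))
        (h₂.mono (Set.prod_mono_right (hI _ (min_le_right _ _))))
        (isClosed_Icc.prod isClosed_Icc) (isClosed_Icc.prod isClosed_Icc)
        (r := fun z => (b, z.2)) (by fun_prop) ?_ ?_
      · rintro ⟨s, t⟩ ⟨hs, ht⟩
        exact ⟨⟨⟨hab, le_rfl⟩, ht⟩, ⟨⟨le_rfl, hbc⟩, ht⟩⟩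
      · rintro ⟨s, t⟩ ⟨⟨hs, ht⟩, ⟨hs', ht'⟩⟩
        exact Prod.ext (le_antisymm hs'.1 hs.2) rfl
    · intro x _
      obtain ⟨N, hN, hNF⟩ := hloc (x, y)
      obtain ⟨ε, hε, hball⟩ := Metric.mem_nhds_iff.1 hN
      refine ⟨ε, hε, fun a b ha hab hb => ⟨ε / 2, by positivity, hNF.mono ?_⟩⟩
      rintro ⟨s, t⟩ ⟨hs, ht⟩
      refine hball ?_
      rw [← ball_prod_same]
      simp only [Set.mem_prod, Metric.mem_ball, Real.dist_eq, abs_lt] at hs ht ⊢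
      exact ⟨⟨by linarith [hs.1], by linarith [hs.2]⟩, ⟨by linarith [ht.1], by linarith [ht.2]⟩⟩
  refine interval_induction (P := fun c d => P.HasFrames σ (Set.Icc 0 1 ×ˢ Set.Icc c d)) ?_ ?_
  · intro a b c hab hbc h₁ h₂
    rw [← Set.Icc_union_Icc_eq_Icc hab hbc, Set.prod_union]
    refine FrameClass.HasFrames.union hσ h₁ h₂ (isClosed_Icc.prod isClosed_Icc)
      (isClosed_Icc.prod isClosed_Icc) (r := fun z => (z.1, b)) (by fun_prop) ?_ ?_
    · rintro ⟨s, t⟩ ⟨hs, ht⟩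
      exact ⟨⟨hs, ⟨hab, le_rfl⟩⟩, ⟨hs, ⟨le_rfl, hbc⟩⟩⟩
    · rintro ⟨s, t⟩ ⟨⟨hs, ht⟩, ⟨hs', ht'⟩⟩
      exact Prod.ext rfl (le_antisymm ht'.1 ht.2)
  · intro y _
    obtain ⟨ε, hε, h⟩ := hrow y
    exact ⟨ε, hε, fun a b ha _ hb => h.mono
      (Set.prod_mono_right (Set.Icc_subset_Icc ha.le hb.le))⟩

/-- A retraction of the plane to the standard triangle. -/
def triangleRetraction (z : ℝ × ℝ) : stdSimplex ℝ (Fin 3) :=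
  ⟨![max 0 (min z.1 1), max 0 (min z.2 (1 - max 0 (min z.1 1))),
      1 - max 0 (min z.1 1) - max 0 (min z.2 (1 - max 0 (min z.1 1)))], by
    have h1 : max 0 (min z.1 1) ≤ 1 := max_le zero_le_one (min_le_right _ _)
    have h2 : max 0 (min z.2 (1 - max 0 (min z.1 1))) ≤ 1 - max 0 (min z.1 1) :=
      max_le (by linarith) (min_le_right _ _)
    refine ⟨fun i => ?_, ?_⟩
    · fin_cases i
      · exact le_max_left _ _
      · exact le_max_left _ _
      · change 0 ≤ 1 - max 0 (min z.1 1) - max 0 (min z.2 (1 - max 0 (min z.1 1)))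
        linarith
    · simp [Fin.sum_univ_three]⟩

theorem continuous_triangleRetraction : Continuous triangleRetraction := by
  refine Continuous.subtype_mk (continuous_pi fun i => ?_) _
  fin_cases i
  · change Continuous fun z : ℝ × ℝ => max 0 (min z.1 1)
    fun_prop
  · change Continuous fun z : ℝ × ℝ => max 0 (min z.2 (1 - max 0 (min z.1 1)))
    fun_prop
  · change Continuous fun z : ℝ × ℝ =>
      1 - max 0 (min z.1 1) - max 0 (min z.2 (1 - max 0 (min z.1 1)))
    fun_prop

theorem triangleRetraction_apply (t : stdSimplex ℝ (Fin 3)) :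
    triangleRetraction (t.1 0, t.1 1) = t := by
  have hs : t.1 0 + t.1 1 + t.1 2 = 1 := by
    rw [← Fin.sum_univ_three]
    exact t.2.2
  have h0 := t.2.1 0
  have h1 := t.2.1 1
  have h2 := t.2.1 2
  have e0 : max 0 (min (t.1 0) 1) = t.1 0 := by
    rw [min_eq_left (by linarith), max_eq_right h0]
  have e1 : max 0 (min (t.1 1) (1 - t.1 0)) = t.1 1 := by
    rw [min_eq_left (by linarith), max_eq_right h1]
  apply Subtype.ext
  funext i
  simp only [triangleRetraction, e0, e1]
  fin_cases i
  · rfl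
  · rfl
  · change 1 - t.1 0 - t.1 1 = t.1 2
    linarith

/-- Frames of the class `P` exist locally over `Y`. -/
def FrameClass.IsLocallyNonempty (P : FrameClass J) (Y : Set X) : Prop :=
  ∀ x ∈ Y, ∃ N ∈ 𝓝 x, P.HasFrames (fun y : Y => (y : X)) (Subtype.val ⁻¹' N)

end Gluing

/-! ### Complex frames and real fiber frames along triangles and edges -/

section FramesAlong

variable {n : ℕ} {X : Type u} [TopologicalSpace X]
  [ChartedSpace (EuclideanSpace ℝ (Fin (2 * n))) X] [IsManifold (𝓡 (2 * n)) ∞ X]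
  {Ω : SymplecticForm n X} {J : CompatibleACS Ω}

/-- The triangle is a retract of the plane, so `σ` extends to the square without leaving its image.
Frames over the square are restricted back. -/
theorem FrameClass.IsLocallyNonempty.hasFrames_triangle {P : FrameClass J} {Y : Set X}
    (hP : P.IsLocallyNonempty Y) (σ : Simplex X 2) (hσ : Set.range σ ⊆ Y) :
    P.HasFrames σ Set.univ := by
  have hloc : ∀ z, ∃ N ∈ 𝓝 z, P.HasFrames (σ ∘ triangleRetraction) N := by
    intro z
    obtain ⟨N, hN, h⟩ := hP (σ (triangleRetraction z)) (hσ ⟨_, rfl⟩)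
    have hc : Continuous (σ ∘ triangleRetraction) :=
      σ.continuous.comp continuous_triangleRetraction
    refine ⟨(σ ∘ triangleRetraction) ⁻¹' N, hc.continuousAt.preimage_mem_nhds hN, ?_⟩
    exact h.comp (g := fun z => (⟨σ (triangleRetraction z), hσ ⟨_, rfl⟩⟩ : Y))
      (hc.subtype_mk _)
  have hsq := FrameClass.hasFrames_square
    (σ.continuous.comp continuous_triangleRetraction) hloc
  have hc : Continuous fun t : stdSimplex ℝ (Fin 3) => (t.1 0, t.1 1) :=
    ((continuous_apply 0).comp continuous_subtype_val).prodMk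
      ((continuous_apply 1).comp continuous_subtype_val)
  have h := (hsq.comp hc).mono (K' := Set.univ) fun t _ =>
    ⟨⟨t.2.1 0, (mem_Icc_of_mem_stdSimplex t.2 0).2⟩, ⟨t.2.1 1,
      (mem_Icc_of_mem_stdSimplex t.2 1).2⟩⟩
  have he : (σ ∘ triangleRetraction) ∘ (fun t : stdSimplex ℝ (Fin 3) => (t.1 0, t.1 1)) = σ := by
    funext t
    simp only [Function.comp_apply, triangleRetraction_apply]
  rwa [he] at h

/-- The edge is the face opposite the vertex `2` of a degenerate triangle whose vertices `1` and `2`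
both map to the end of the edge. -/
theorem FrameClass.IsLocallyNonempty.hasFrames_edge {P : FrameClass J} {Y : Set X}
    (hP : P.IsLocallyNonempty Y) (e : Simplex X 1) (he : Set.range e ⊆ Y) :
    P.HasFrames e Set.univ := by
  let g : C(stdSimplex ℝ (Fin 3), stdSimplex ℝ (Fin 2)) :=
    ⟨stdSimplex.map ![0, 1, 1], stdSimplex.continuous_map _⟩
  have h := (hP.hasFrames_triangle (e.comp g) ((Set.range_comp_subset_range g e).trans he)).comp
    (faceMap (2 : Fin 3)).continuous
  have hge : (e.comp g) ∘ faceMap (2 : Fin 3) = e := by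
    funext t
    refine congrArg e ?_
    change stdSimplex.map ![0, 1, 1] (stdSimplex.map (2 : Fin 3).succAbove t) = t
    rw [stdSimplex.map_comp_apply]
    have : (![0, 1, 1] : Fin 3 → Fin 2) ∘ (2 : Fin 3).succAbove = id := by decide
    rw [this, stdSimplex.map_id_apply]
  rwa [hge] at h

theorem FrameClass.HasFrames.exists_frameAlong {P : FrameClass J} {k : ℕ} {σ : Simplex X k}
    (h : P.HasFrames σ Set.univ) : ∃ F : FrameAlong J σ, ∀ t, P.mem (σ t) (F.vec t) := by
  obtain ⟨vec, h1, h2⟩ := h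
  exact ⟨⟨vec, fun i => continuousOn_univ.1 (h1 i), fun t => P.isFrame (h2 t trivial)⟩,
    fun t => h2 t trivial⟩

variable (J) in
/-- The class of all complex frames. -/
def complexFrames : FrameClass J where
  mem x v := IsComplexFrame J x v
  isFrame h := h
  act_mem hv hw hg := hg.act_iff.2 (hv.det_transMat_ne_zero hw)

variable (J) in
theorem isLocallyNonempty_complexFrames : (complexFrames J).IsLocallyNonempty Set.univ := by
  intro x _
  obtain ⟨V, u, hV, hxV, hu, huc⟩ := exists_local_frame J x
  refine ⟨V, hV.mem_nhds hxV, fun y => u y, fun i y hy => ?_, fun y hy => hu y hy⟩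
  exact (ContinuousAt.comp (g := fun y => (⟨y, u y i⟩ : TanBundle n X)) (huc i y hy)
    continuous_subtype_val.continuousAt).continuousWithinAt

variable (J) in
theorem exists_frameAlong_triangle (σ : Simplex X 2) : Nonempty (FrameAlong J σ) :=
  ⟨((isLocallyNonempty_complexFrames J).hasFrames_triangle σ
    (Set.subset_univ _)).exists_frameAlong.choose⟩

variable (J) in
theorem exists_frameAlong_edge (e : Simplex X 1) : Nonempty (FrameAlong J e) :=
  ⟨((isLocallyNonempty_complexFrames J).hasFrames_edge e
    (Set.subset_univ _)).exists_frameAlong.choose⟩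

variable {B : Type v}

theorem IsFiberFrame.exists_real {f : X → B} {x : X} {v w : Fin n → Tan n x}
    (hv : IsFiberFrame Ω f x v) (hw : IsFiberFrame Ω f x w) :
    ∃ R : Matrix (Fin n) (Fin n) ℝ, transMat J v w = R.map Complex.ofReal := by
  obtain ⟨R, hR⟩ := exists_real_of_mem_span J (v := v) (w := w) fun j => by
    rw [hv.2.2]
    exact hw.mem j
  exact ⟨R, by rw [hR, (hv.isComplexFrame (J := J)).transMat_act]⟩

variable (J) in
/-- The class of real frames of the tangent spaces of the fibers. -/
def fiberFrames (f : X → B) : FrameClass J where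
  mem x v := IsFiberFrame Ω f x v
  isFrame h := h.isComplexFrame
  act_mem {x y v w g} hv hw hg := by
    refine isFiberFrame_of_mem (J := J) hg.1 (hg.isComplexFrame.act_iff.2
      (hv.isComplexFrame.det_transMat_ne_zero hw.isComplexFrame)) fun i => ?_
    obtain ⟨R, hR⟩ := hv.exists_real (J := J) hw
    rw [hR]
    exact act_ofReal_mem J hg.mem R i

variable (J) in
-- If `M = A conj(A)⁻¹`, then `c ↦ (c + M conj(c)) / 2 = A Re(A⁻¹ c)` is the real projection of `ℂⁿ`
-- onto the plane `A ℝⁿ`. It depends only on `M`, which is continuous. A basis `C` of the plane at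
-- `x` is thus projected continuously to the nearby planes; it is unchanged at `x`, so it remains a
-- frame nearby.
theorem IsTame.isLocallyNonempty_fiberFrames {f : X → B} (hf : IsTame Ω f) :
    (fiberFrames J f).IsLocallyNonempty (smoothLocus Ω f) := by
  intro x hx
  obtain ⟨V, u, hV, hxV, hu, huc⟩ := exists_local_frame J x
  obtain ⟨M, hM, hMv⟩ := hf.exists_continuousOn_lagMat hV hu huc
  obtain ⟨v₀, hv₀⟩ := exists_isFiberFrame (J := J) hx
  set C := transMat J (u x) v₀ with hC
  have hCdet : C.det ≠ 0 := (hu x hxV).det_transMat_ne_zero hv₀.isComplexFrame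
  let K : X → Matrix (Fin n) (Fin n) ℂ := fun y => (1 / 2 : ℂ) • (C + M y * conjMat C)
  have hKc : ContinuousOn K (V ∩ smoothLocus Ω f) := by
    have h1 : Continuous fun D : Matrix (Fin n) (Fin n) ℂ =>
        (1 / 2 : ℂ) • (C + D * conjMat C) := by
      have h2 : Continuous fun D : Matrix (Fin n) (Fin n) ℂ => D * conjMat C :=
        continuous_id.matrix_mul continuous_const
      have h3 : Continuous fun D : Matrix (Fin n) (Fin n) ℂ => C + D * conjMat C :=
        continuous_const.add h2
      exact h3.const_smul (1 / 2 : ℂ)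
    exact h1.comp_continuousOn hM
  have hunit : ∀ A : Matrix (Fin n) (Fin n) ℂ, A.det ≠ 0 → IsUnit (conjMat A).det := by
    intro A hA
    rw [det_conjMat]
    exact IsUnit.mk0 _ (by simpa using hA)
  have hKx : K x = C := by
    simp only [K]
    rw [hMv x hxV v₀ hv₀, lagMat, ← hC, Matrix.nonsing_inv_mul_cancel_right _ _ (hunit C hCdet),
      ← two_smul ℂ C, smul_smul]
    norm_num
  have hmem : ∀ y ∈ V, y ∈ smoothLocus Ω f → ∀ i,
      act J (u y) (K y) i ∈ tangentTo n (f ⁻¹' {f y}) y := by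
    intro y hy hyG i
    obtain ⟨v, hv⟩ := exists_isFiberFrame (J := J) hyG
    set A := transMat J (u y) v with hA
    have hAdet : A.det ≠ 0 := (hu y hy).det_transMat_ne_zero hv.isComplexFrame
    have hre : K y = A * ((A⁻¹ * C).map Complex.re).map Complex.ofReal := by
      have h1 : ((A⁻¹ * C).map Complex.re).map Complex.ofReal =
          (1 / 2 : ℂ) • (A⁻¹ * C + conjMat (A⁻¹ * C)) := by
        ext i j
        simp only [Matrix.map_apply, Matrix.smul_apply, Matrix.add_apply, conjMat_apply,
          smul_eq_mul, Complex.add_conj]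
        push_cast
        ring
      have h2 : conjMat A⁻¹ = (conjMat A)⁻¹ := by
        symm
        apply Matrix.inv_eq_left_inv
        rw [← map_mul, Matrix.nonsing_inv_mul _ hAdet.isUnit, map_one]
      rw [h1, Matrix.mul_smul, Matrix.mul_add,
        Matrix.mul_nonsing_inv_cancel_left _ _ hAdet.isUnit, map_mul, h2, ← Matrix.mul_assoc]
      simp only [K]
      rw [hMv y hy v hv, lagMat]
    have h3 : act J (u y) (K y) = act J v (((A⁻¹ * C).map Complex.re).map Complex.ofReal) := by
      rw [hre, ← act_act, hA, (hu y hy).act_transMat]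
    rw [h3]
    exact act_ofReal_mem J hv.mem _ i
  have hdet : ∀ᶠ y in 𝓝[V ∩ smoothLocus Ω f] x, (K y).det ≠ 0 := by
    have h2 : Continuous fun B : Matrix (Fin n) (Fin n) ℂ => B.det := continuous_id.matrix_det
    have h3 : ContinuousWithinAt (fun y => (K y).det) (V ∩ smoothLocus Ω f) x :=
      h2.continuousAt.comp_continuousWithinAt (hKc x ⟨hxV, hx⟩)
    exact h3.eventually (isOpen_ne.mem_nhds (by
      change (K x).det ≠ 0
      rw [hKx]
      exact hCdet))
  obtain ⟨N, hN, hNdet⟩ := mem_nhdsWithin_iff_exists_mem_nhds_inter.1 hdet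
  refine ⟨N ∩ V, Filter.inter_mem hN (hV.mem_nhds hxV), fun y => act J (u y) (K y),
    fun i y hy => ?_, fun y hy => ?_⟩
  · have h1 : ContinuousWithinAt (fun z => (⟨z, act J (u z) (K z) i⟩ : TanBundle n X))
        (V ∩ smoothLocus Ω f) y :=
      continuousWithinAt_act (σ := id) continuousWithinAt_id
        (fun i => (huc i y hy.2).continuousWithinAt) (hKc y ⟨hy.2, y.2⟩) i
    exact ContinuousWithinAt.comp (f := fun y : smoothLocus Ω f => (y : X)) h1
      continuous_subtype_val.continuousWithinAt fun z hz => ⟨hz.2, z.2⟩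
  · exact isFiberFrame_of_mem (J := J) y.2 ((hu y hy.2).act_iff.2 (hNdet ⟨hy.1, hy.2, y.2⟩))
      (hmem y hy.2 y.2)

end FramesAlong

/-! ### Existence of framings and of winding numbers -/

section Framings

variable {n : ℕ} {X : Type u} [TopologicalSpace X]
  [ChartedSpace (EuclideanSpace ℝ (Fin (2 * n))) X] [IsManifold (𝓡 (2 * n)) ∞ X]
  {Ω : SymplecticForm n X} {J : CompatibleACS Ω}

/-- A complex frame along an edge can be rotated so as to match given frames at the end points. -/
theorem exists_matching_frame (e : Simplex X 1) (vf : ∀ x : X, Fin n → Tan n x)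
    (hvf : ∀ x, IsComplexFrame J x (vf x)) (m : ℕ) :
    ∃ F : FrameAlong J e, ∀ j : Fin 2, ∃ A : Matrix (Fin n) (Fin n) ℂ,
      IsTransition J (e (stdSimplex.vertex j)) (vf (e (stdSimplex.vertex j)))
        (F.vec (stdSimplex.vertex j)) A ∧ ∃ r : ℝ, 0 < r ∧ A.det ^ m = r := by
  obtain ⟨F⟩ := exists_frameAlong_edge J e
  let A : Fin 2 → Matrix (Fin n) (Fin n) ℂ := fun j =>
    transMat J (vf (e (stdSimplex.vertex j))) (F.vec (stdSimplex.vertex j))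
  let α : stdSimplex ℝ (Fin 2) → ℝ := fun t => t.1 0 * (A 0).det.arg + t.1 1 * (A 1).det.arg
  have hα : Continuous α :=
    (((continuous_apply 0).comp continuous_subtype_val).mul continuous_const).add
      (((continuous_apply 1).comp continuous_subtype_val).mul continuous_const)
  have hαv : ∀ j, α (stdSimplex.vertex j) = (A j).det.arg := by
    intro j
    fin_cases j <;> simp [α, stdSimplex.vertex]
  -- A scalar matrix `c` has determinant `cⁿ`, so dividing by `n` makes the rotation cancel the
  -- argument of the mismatch at both ends. For `n = 0` all determinants are `1` and nothing has to
  -- be cancelled.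
  let c : stdSimplex ℝ (Fin 2) → ℂ := fun t => Complex.exp (-(α t / n : ℝ) * Complex.I)
  have hc : Continuous c := by
    have := hα.div_const (n : ℝ)
    exact Complex.continuous_exp.comp ((Complex.continuous_ofReal.comp this).neg.mul
      continuous_const)
  have hc0 : ∀ t, c t ≠ 0 := fun t => Complex.exp_ne_zero _
  let D : stdSimplex ℝ (Fin 2) → Matrix (Fin n) (Fin n) ℂ := fun t => c t • 1
  have hDdet : ∀ t, (D t).det = c t ^ n := fun t => by simp [D]
  refine ⟨⟨fun t => act J (F.vec t) (D t), fun i => ?_, fun t => ?_⟩, fun j => ?_⟩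
  · rw [continuous_iff_continuousAt]
    intro t
    rw [← continuousWithinAt_univ]
    exact continuousWithinAt_act e.continuous.continuousWithinAt
      (fun i => (F.continuous i).continuousWithinAt)
      (hc.smul continuous_const).continuousWithinAt i
  · rw [(F.isFrame t).act_iff, hDdet]
    exact pow_ne_zero _ (hc0 t)
  · have hA0 : (A j).det ≠ 0 := (hvf _).det_transMat_ne_zero (F.isFrame _)
    have hdet : (A j * D (stdSimplex.vertex j)).det = ‖(A j).det‖ := by
      rw [Matrix.det_mul, hDdet]
      rcases Nat.eq_zero_or_pos n with hn | hn
      · subst hn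
        simp [Matrix.det_isEmpty]
      · have hn' : (n : ℂ) ≠ 0 := by exact_mod_cast hn.ne'
        have h1 : c (stdSimplex.vertex j) ^ n = Complex.exp (-((A j).det.arg * Complex.I)) := by
          simp only [c]
          rw [← Complex.exp_nat_mul, hαv]
          congr 1
          push_cast
          field_simp
        rw [h1]
        nth_rewrite 1 [← Complex.norm_mul_exp_arg_mul_I (A j).det]
        rw [mul_assoc, ← Complex.exp_add, add_neg_cancel, Complex.exp_zero, mul_one]
    refine ⟨A j * D (stdSimplex.vertex j), ?_, ‖(A j).det‖ ^ m,
      pow_pos (norm_pos_iff.2 hA0) m, ?_⟩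
    · rw [isTransition_iff, ← act_act, (hvf _).act_transMat]
    · rw [hdet]
      push_cast
      rfl

variable {B : Type v}

/-- Framings exist, and along a subset of the smooth locus they can be chosen to consist of real
frames of the tangent spaces of the fibers if `m` is even. -/
theorem exists_framing (J : CompatibleACS Ω) {f : X → B} {Y : Set X} (hY : Y ⊆ smoothLocus Ω f)
    (hf : Y.Nonempty → IsTame Ω f) {m : ℕ} (hm : Y.Nonempty → Even m) :
    ∃ Φ : Framing J m, ∀ e : Simplex X 1, Set.range e ⊆ Y → ∀ t,
      IsFiberFrame Ω f (e t) ((Φ.edgeFrame e).vec t) := by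
  classical
  have hvf : ∀ x, ∃ v, IsComplexFrame J x v ∧ (x ∈ Y → IsFiberFrame Ω f x v) := by
    intro x
    by_cases hx : x ∈ Y
    · obtain ⟨v, hv⟩ := exists_isFiberFrame (J := J) (hY hx)
      exact ⟨v, hv.isComplexFrame, fun _ => hv⟩
    · obtain ⟨v, hv⟩ := exists_isComplexFrame J x
      exact ⟨v, hv, fun h => absurd h hx⟩
  choose vf hvf hvfY using hvf
  have hedge : ∀ e : Simplex X 1, ∃ F : FrameAlong J e,
      (∀ j : Fin 2, ∃ A : Matrix (Fin n) (Fin n) ℂ,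
        IsTransition J (e (stdSimplex.vertex j)) (vf (e (stdSimplex.vertex j)))
          (F.vec (stdSimplex.vertex j)) A ∧ ∃ r : ℝ, 0 < r ∧ A.det ^ m = r) ∧
      (Set.range e ⊆ Y → ∀ t, IsFiberFrame Ω f (e t) (F.vec t)) := by
    intro e
    by_cases he : Set.range e ⊆ Y
    · have hne : Y.Nonempty := ⟨_, he ⟨stdSimplex.vertex (0 : Fin 2), rfl⟩⟩
      obtain ⟨F, hF⟩ := (((hf hne).isLocallyNonempty_fiberFrames J).hasFrames_edge e
        (he.trans hY)).exists_frameAlong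
      refine ⟨F, fun j => ?_, fun _ => hF⟩
      set x := e (stdSimplex.vertex j)
      have h1 := hvfY x (he ⟨_, rfl⟩)
      obtain ⟨R, hR⟩ := h1.exists_real (J := J) (hF (stdSimplex.vertex j))
      have h2 := (hvf x).det_transMat_ne_zero (F.isFrame (stdSimplex.vertex j))
      -- Two real frames of one plane differ by a real matrix. Its determinant may be negative, but
      -- an even power is positive, so no rotation is needed here.
      refine ⟨_, (hvf x).isTransition _, R.det ^ m, (hm hne).pow_pos ?_, ?_⟩
      · intro h0
        rw [hR, det_map_ofReal, h0] at h2
        exact h2 rfl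
      · rw [hR, det_map_ofReal]
        push_cast
        rfl
    · obtain ⟨F, hF⟩ := exists_matching_frame e vf hvf m
      exact ⟨F, hF, fun h => absurd h he⟩
  choose F hF hFY using hedge
  exact ⟨⟨vf, hvf, F, hF⟩, hFY⟩

/-- Winding numbers exist. -/
theorem Framing.exists_isWinding {m : ℕ} (Φ : Framing J m) (σ : Simplex X 2) :
    ∃ k : ℤ, Φ.IsWinding σ k := by
  have hpi : (2 * Real.pi) ≠ 0 := Real.two_pi_pos.ne'
  obtain ⟨F⟩ := exists_frameAlong_triangle J σ
  -- At each vertex, `d` fixes one argument of the vertex frame relative to `F`; it need not be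
  -- continuous. Each edge lift differs from it at the ends by multiples of `2π`, and the values of
  -- `d` cancel around the triangle, so the total rotation is an integer.
  choose d hd using fun t => Circle.exp_surjective
    (phase ((transMat J (F.vec t) (Φ.vertexFrame (σ t))).det ^ m))
  let A : ∀ i : Fin 3, stdSimplex ℝ (Fin 2) → Matrix (Fin n) (Fin n) ℂ := fun i t =>
    transMat J ((F.face i).vec t) ((Φ.edgeFrame (face σ i)).vec t)
  have hA0 : ∀ i t, (A i t).det ≠ 0 := fun i t =>
    ((F.face i).isFrame t).det_transMat_ne_zero ((Φ.edgeFrame (face σ i)).isFrame t)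
  have hAc : ∀ i, Continuous (A i) := by
    intro i
    rw [continuous_iff_continuousAt]
    intro t
    rw [← continuousWithinAt_univ]
    exact continuousWithinAt_transMat (face σ i).continuous.continuousWithinAt
      (fun k => ((F.face i).continuous k).continuousWithinAt)
      (fun k => ((Φ.edgeFrame (face σ i)).continuous k).continuousWithinAt)
      ((F.face i).isFrame t)
  have hτ : ∀ i, Continuous fun t => phase ((A i t).det ^ m) := by
    intro i
    rw [continuous_iff_continuousAt]
    intro t
    exact ContinuousAt.comp (g := phase) (f := fun t => (A i t).det ^ m)
      (continuousAt_phase (pow_ne_zero m (hA0 i t))) (((hAc i).matrix_det.pow m).continuousAt)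
  choose θ hθ hθτ using fun i => exists_lift_simplex (hτ i)
  have hv : ∀ (i : Fin 3) (j : Fin 2), ∃ k : ℤ, θ i (stdSimplex.vertex j) -
      d (stdSimplex.vertex (i.succAbove j)) = k * (2 * Real.pi) := by
    intro i j
    rw [← faceMap_vertex]
    refine exists_int_of_exp_eq ?_
    rw [hθτ, hd]
    obtain ⟨C, hC, r, hr, hCr⟩ := Φ.matching (face σ i) j
    have h1 := (Φ.vertexFrame_isFrame (face σ i (stdSimplex.vertex j))).transMat_eq hC
    have h2 := (Φ.vertexFrame_isFrame (face σ i (stdSimplex.vertex j))).det_transMat_ne_zero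
      ((Φ.edgeFrame (face σ i)).isFrame (stdSimplex.vertex j))
    have h3 : A i (stdSimplex.vertex j) = transMat J ((F.face i).vec (stdSimplex.vertex j))
        (Φ.vertexFrame (face σ i (stdSimplex.vertex j))) * C := by
      rw [← h1, ((F.face i).isFrame _).transMat_mul (Φ.vertexFrame_isFrame _)]
    rw [h1] at h2
    have h4 := ((F.face i).isFrame (stdSimplex.vertex j)).det_transMat_ne_zero
      (Φ.vertexFrame_isFrame (face σ i (stdSimplex.vertex j)))
    rw [h3, Matrix.det_mul, mul_pow, phase_mul (pow_ne_zero m h4) (pow_ne_zero m h2), hCr,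
      phase_ofReal hr, mul_one]
    rfl
  choose k hk using hv
  refine ⟨(k 0 1 - k 0 0) - (k 1 1 - k 1 0) + (k 2 1 - k 2 0), F,
    fun i => (θ i (stdSimplex.vertex 1) - θ i (stdSimplex.vertex 0)) / (2 * Real.pi),
    fun i => ⟨A i, θ i, fun t => ((F.face i).isFrame t).isTransition _, hθ i, fun t => ?_, ?_⟩, ?_⟩
  · exact (eq_norm_mul_exp_iff (pow_ne_zero m (hA0 i t)) _).2 (hθτ i t)
  · field_simp
  · have h00 := hk 0 0
    have h01 := hk 0 1
    have h10 := hk 1 0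
    have h11 := hk 1 1
    have h20 := hk 2 0
    have h21 := hk 2 1
    rw [show (0 : Fin 3).succAbove (0 : Fin 2) = 1 by decide] at h00
    rw [show (0 : Fin 3).succAbove (1 : Fin 2) = 2 by decide] at h01
    rw [show (1 : Fin 3).succAbove (0 : Fin 2) = 0 by decide] at h10
    rw [show (1 : Fin 3).succAbove (1 : Fin 2) = 2 by decide] at h11
    rw [show (2 : Fin 3).succAbove (0 : Fin 2) = 0 by decide] at h20
    rw [show (2 : Fin 3).succAbove (1 : Fin 2) = 1 by decide] at h21
    rw [← sub_div, ← add_div, eq_div_iff hpi]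
    push_cast
    linarith

end Framings

end LagFib

end

/-! ### Torsion of the first Chern class and vanishing of the Maslov class -/

open LagFib in
theorem propositionA1 {n : ℕ}
    {X : Type*} [TopologicalSpace X] [T2Space X] [SecondCountableTopology X]
    [ChartedSpace (EuclideanSpace ℝ (Fin (2 * n))) X] [IsManifold (𝓡 (2 * n)) ∞ X]
    {B : Type*} [TopologicalSpace B] [T2Space B] [SecondCountableTopology B]
    [ChartedSpace (EuclideanSpace ℝ (Fin n)) B] [IsManifold (𝓡 n) ∞ B]
    (Ω : LagFib.SymplecticForm n X) (f : X → B)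
    (hf : LagFib.IsLagrangianFibration Ω f) (htame : LagFib.IsTame Ω f)
    (hcodim : LagFib.HasCodimAtLeast n (LagFib.smoothLocus Ω f)ᶜ 3)
    (J : LagFib.CompatibleACS Ω) :
    ((∃ c : LagFib.H2 X, LagFib.IsFirstChernClass J c) ∧
      ∀ c : LagFib.H2 X, LagFib.IsFirstChernClass J c → IsOfFinAddOrder c) ∧
    ∀ b : B, LagFib.IsSmoothFiber Ω f b →
      (∃ μ : LagFib.RelH2 (f ⁻¹' {b}) →+ ℤ, LagFib.IsMaslovClass J (f ⁻¹' {b}) μ) ∧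
      ∀ μ : LagFib.RelH2 (f ⁻¹' {b}) →+ ℤ, LagFib.IsMaslovClass J (f ⁻¹' {b}) μ → μ = 0 := by
  obtain ⟨S, ζ, hζ, hSζ⟩ := exists_phaseSection J htame hcodim
  have hchern : ∀ (Φ : Framing J 1) (k : Simplex X 2 → ℤ), (∀ σ, Φ.IsWinding σ (k σ)) →
      ∃ h : Cochain X 1, (2 : ℕ) • k = coboundary X 1 h := by
    intro Φ k hk
    obtain ⟨h, hh, -⟩ := Φ.sq.exists_eq_coboundary S ζ
    refine ⟨h, funext fun σ => ?_⟩
    rw [coboundary_one_apply, ← hh σ _ (hk σ).sq]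
    simp
  refine ⟨⟨?_, ?_⟩, fun b hb => ?_⟩
  -- With `Y` empty no edge has to carry fiber frames, so the odd power `m = 1` is allowed.
  · obtain ⟨Φ, -⟩ := exists_framing J (f := f) (Y := ∅) (Set.empty_subset _)
      (fun h => absurd h Set.not_nonempty_empty) (m := 1)
      (fun h => absurd h Set.not_nonempty_empty)
    choose k hk using Φ.exists_isWinding
    obtain ⟨h, hh⟩ := hchern Φ k hk
    have hcoc : k ∈ Cocycle X 2 := by
      -- The winding cochain is closed because its double is exact and integral cochains have no
      -- torsion.
      have h1 : (2 : ℕ) • coboundary X 2 k = 0 := by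
        rw [← map_nsmul, hh, coboundary_coboundary]
      exact (smul_eq_zero.1 h1).resolve_left two_ne_zero
    exact ⟨_, Φ, ⟨k, hcoc⟩, hk, rfl⟩
  · rintro _ ⟨Φ, z, hz, rfl⟩
    obtain ⟨h, hh⟩ := hchern Φ z.1 hz
    rw [isOfFinAddOrder_iff_nsmul_eq_zero]
    refine ⟨2, two_pos, ?_⟩
    rw [← QuotientAddGroup.mk_nsmul, QuotientAddGroup.eq_zero_iff, AddSubgroup.mem_addSubgroupOf]
    exact ⟨h, hh.symm⟩
  · have hL : f ⁻¹' {b} ⊆ smoothLocus Ω f := fun x hx =>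
      Set.mem_iUnion.2 ⟨b, by rw [show smoothPart Ω f b = f ⁻¹' {b} from hb]; exact hx⟩
    have hzero : ∀ (Φ : Framing J 2) (k : Simplex X 2 → ℤ), Φ.IsAdapted (f ⁻¹' {b}) →
        (∀ σ, Φ.IsWinding σ (k σ)) → ∀ z : relCycles2 (f ⁻¹' {b}),
          (z.1.sum fun σ a => a * k σ) = 0 := by
      intro Φ k hΦ hk z
      -- Along an edge in the fiber an adapted framing consists of fiber frames, on which `S` equals
      -- `exp ζ` with `ζ` continuous; so `h` vanishes there.
      obtain ⟨h, hh, hvan⟩ := Φ.exists_eq_coboundary S ζ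
      refine sum_mul_coboundary_eq_zero (fun e he => hvan e ?_ fun t => ?_) z
        fun σ => hh σ _ (hk σ)
      · exact hζ.comp_continuous e.continuous fun t => hL (he ⟨t, rfl⟩)
      · refine hSζ _ _ (isFiberFrame_of_mem (J := J) (hL (he ⟨t, rfl⟩))
          ((Φ.edgeFrame e).isFrame t) fun i => ?_)
        rw [show f (e t) = b from he ⟨t, rfl⟩]
        exact hΦ e he t i
    refine ⟨?_, ?_⟩
    · obtain ⟨Φ, hΦ⟩ := exists_framing J (m := 2) hL (fun _ => htame) (fun _ => even_two)
      choose k hk using Φ.exists_isWinding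
      have had : Φ.IsAdapted (f ⁻¹' {b}) := fun e he t i => by
        have h1 := (hΦ e he t).mem i
        rwa [show f (e t) = b from he ⟨t, rfl⟩] at h1
      -- The sums of winding numbers vanish on every relative cycle, so the zero homomorphism
      -- represents the Maslov class and descent to homology needs no separate check.
      exact ⟨0, Φ, k, had, hk, fun z => (hzero Φ k had hk z).symm⟩
    · rintro μ ⟨Φ, k, hΦ, hk, hμ⟩
      ext z
      obtain ⟨z, rfl⟩ := Submodule.Quotient.mk_surjective _ z
      rw [hμ z, hzero Φ k hΦ hk z]
      rfl
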